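/- Let $\mathbb{G}$ be a Carnot group of step $s$, that is, a simply connected Lie group whose Lie algebra has a stratification $\mathfrak{g}=V_1\oplus\dots\oplus V_s$ with $[V_1,V_i]=V_{i+1}$ for $1\le i\le s-1$ and $[V_1,V_s]=\{0\}$. Fix a basis $X_1,\dots,X_N$ of $\mathfrak{g}$ (the Lie algebra of left invariant vector fields) adapted to the stratification: listing the basis in order, first come the elements of a basis of $V_1$, then those of a basis of $V_2$, and so on. Put $d_i=j$ if $X_i\in V_j$, and $Q=\sum_{i=1}^s i\dim V_i$. Identify $\mathbb{G}$ with $\mathbb{R}^N$ through the exponential coordinates $\exp(x_1X_1+\dots+x_NX_N)\leftrightarrow(x_1,\dots,x_N)$, and let $\mathcal{L}^N$ be Lebesgue measure on $\mathbb{R}^N$. Let $B(x_0,r)$ be the open ball of the Carnot–Carathéodory distance $d(x,y)=\inf\int_0^1|u(t)|\,dt$, the infimum being over the absolutely continuous curves $\gamma\colon[0,1]\to\mathbb{G}$ from $x$ to $y$ with $\gamma'=\sum_{j=1}^{m}u_jX_j(\gamma)$ almost everywhere for some $u\in L^1([0,1];\mathbb{R}^{m})$, where $m=\dim V_1$. For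 a multi-index $\alpha=(\alpha_1,\dots,\alpha_N)$ of non-negative integers put $|\alpha|_{\mathbb{G}}=\sum_i d_i\alpha_i$ and $X^\alpha=X_1^{\alpha_1}\cdots X_N^{\alpha_N}$. A polynomial of homogeneous degree at most $k$ is a linear combination of monomials $x_1^{j_1}\cdots x_N^{j_N}$ with $\sum_i d_ij_i\le k$. Let $k$ be a positive integer and $A>0$. Then there is a constant $C>0$, depending only on $k$, $A$ and the group $\mathbb{G}$ with its fixed stratification and basis, such that for all $x_0\in\mathbb{G}$, all $r>0$, all Lebesgue measurable sets $E\subset B(x_0,r)$ with $\mathcal{L}^N(E)\ge A r^Q$, all polynomials $P$ of homogeneous degree at most $k$ and all multi-indices $\alpha$, \[ |X^{\alpha}P(x_0)|\le \frac{C}{r^{Q+|\alpha|_{\mathbb{G}}}}\int_E |P(y)|\,dy . \] -/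

import Mathlib

open MeasureTheory Set
open scoped Manifold ContDiff ENNReal

noncomputable section

/-- The underlying manifold `ℝ^N` of a Carnot group in exponential coordinates.  The group law is a
separate (multiplicative) `Group` instance, not the addition of `ℝ^N`. -/
abbrev RN (N : ℕ) : Type := EuclideanSpace ℝ (Fin N)

section General

variable {N : ℕ} [Group (RN N)]

/-- The Lie algebra `𝔤` of a Lie group on `ℝ^N`: the tangent space at the identity, `v` standing for
the left invariant vector field `mulInvariantVectorField v`; its bracket is the bracket of left
invariant vector fields. -/
abbrev LieAlg (N : ℕ) [Group (RN N)] : Type := GroupLieAlgebra 𝓘(ℝ, RN N) (RN N)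

/-- `IsLieExp v g` says `exp v = g`: the integral curve of the left invariant field `v` which starts
at the identity is at `g` at time one. -/
def IsLieExp (v : LieAlg N) (g : RN N) : Prop :=
  ∃ γ : ℝ → RN N, γ 0 = 1 ∧
    IsMIntegralCurve (I := 𝓘(ℝ, RN N)) γ (mulInvariantVectorField v) ∧ γ 1 = g

/-- The subspaces `V 1, …, V s` form a stratification of step `s` of the Lie algebra.  The values of
`V` outside `{1, …, s}` play no role. -/
structure IsStratification (s : ℕ) (V : ℕ → Submodule ℝ (LieAlg N)) : Prop where
  one_le_step : 1 ≤ s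
  directSum : DirectSum.IsInternal fun i : Fin s ↦ V (i + 1)
  bracket_layer : ∀ i, 1 ≤ i → i + 1 ≤ s →
    Submodule.span ℝ {c | ∃ a ∈ V 1, ∃ b ∈ V i, ⁅a, b⁆ = c} = V (i + 1)
  bracket_top : ∀ a ∈ V 1, ∀ b ∈ V s, ⁅a, b⁆ = 0

end General

/-- A Carnot group in exponential coordinates: a Lie group structure on `ℝ^N` with a stratified Lie
algebra and a basis `X` of the Lie algebra adapted to the stratification, such that
`exp (x₁ X₁ + ⋯ + x_N X_N)` is the point `x = (x₁, …, x_N)`.  (`ℝ^N` is simply connected, and every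
simply connected Lie group with a stratified Lie algebra and an adapted basis takes this form by
transport along its exponential map.) -/
structure CarnotGroup (N : ℕ) [Group (RN N)] [LieGroup 𝓘(ℝ, RN N) ∞ (RN N)] where
  /-- the step `s` -/
  step : ℕ
  /-- the layers `V 1, …, V s` -/
  V : ℕ → Submodule ℝ (LieAlg N)
  stratification : IsStratification step V
  /-- the adapted basis `X₁, …, X_N` -/
  X : Module.Basis (Fin N) ℝ (LieAlg N)
  /-- the homogeneities `d₁ ≤ ⋯ ≤ d_N`: `d i` is the index of the layer that contains `X i` -/
  d : Fin N → ℕ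
  d_mono : Monotone d
  d_mem : ∀ i, d i ∈ Icc 1 step
  adapted : ∀ j ∈ Icc 1 step, V j = Submodule.span ℝ (X '' {i | d i = j})
  exp_coord : ∀ x : RN N, IsLieExp (∑ i, x i • X i) x

namespace CarnotGroup

variable {N : ℕ} [Group (RN N)] [LieGroup 𝓘(ℝ, RN N) ∞ (RN N)] (𝔾 : CarnotGroup N)

/-- The homogeneous dimension `Q = ∑ i, i * dim V_i`. -/
def homDim : ℕ := ∑ i ∈ Finset.Icc 1 𝔾.step, i * Module.finrank ℝ (𝔾.V i)

/-- The left invariant vector field `X_i`, as a map from `ℝ^N` to `ℝ^N`. -/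
def field (i : Fin N) (x : RN N) : RN N :=
  mulInvariantVectorField (I := 𝓘(ℝ, RN N)) (𝔾.X i) x

/-- The derivative `X_i f` of a function `f` along the vector field `X_i`. -/
def deriv (i : Fin N) (f : RN N → ℝ) (x : RN N) : ℝ := fderiv ℝ f x (𝔾.field i x)

/-- `X^α f = X₁^{α₁} (X₂^{α₂} (⋯ (X_N^{α_N} f)))`. -/
def iterDeriv (α : Fin N → ℕ) (f : RN N → ℝ) : RN N → ℝ :=
  (List.finRange N).foldr (fun i g ↦ (𝔾.deriv i)^[α i] g) f

/-- The homogeneous norm `∑ d_i α_i` of a multi-index. -/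
def homNorm (α : Fin N → ℕ) : ℕ := ∑ i, 𝔾.d i * α i

/-- `γ : [0,1] → ℝ^N` is an absolutely continuous horizontal curve with controls `u ∈ L¹([0,1])`,
indexed by the basis of the first layer: `γ' = ∑ u_j X_j(γ)` almost everywhere. -/
structure IsHorizontal (γ : ℝ → RN N) (u : ℝ → EuclideanSpace ℝ {j : Fin N // 𝔾.d j = 1}) :
    Prop where
  differentiable_ae : ∀ᵐ t ∂volume.restrict (Icc (0 : ℝ) 1), DifferentiableAt ℝ γ t
  integrable_deriv : IntegrableOn (_root_.deriv γ) (Icc 0 1)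
  integral_deriv : ∀ t₁ ∈ Icc (0 : ℝ) 1, ∀ t₂ ∈ Icc (0 : ℝ) 1,
    γ t₂ - γ t₁ = ∫ t in t₁..t₂, _root_.deriv γ t
  integrable_control : IntegrableOn u (Icc 0 1)
  deriv_eq : ∀ᵐ t ∂volume.restrict (Icc (0 : ℝ) 1),
    _root_.deriv γ t = ∑ j, u t j • 𝔾.field j.1 (γ t)

/-- The Carnot–Carathéodory distance: the infimum of the horizontal lengths `∫ |u|` of the
horizontal curves joining `x` to `y`, with values in `[0, ∞]` (`∞` if there is no such curve). -/
def ccDist (x y : RN N) : ℝ≥0∞ :=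
  sInf {L | ∃ γ u, 𝔾.IsHorizontal γ u ∧ γ 0 = x ∧ γ 1 = y ∧
    L = ENNReal.ofReal (∫ t in (0 : ℝ)..1, ‖u t‖)}

/-- The Carnot–Carathéodory ball `B(x, r)`. -/
def ball (x : RN N) (r : ℝ) : Set (RN N) := {y | 𝔾.ccDist x y < ENNReal.ofReal r}

/-- `P`, a polynomial in the coordinates `x₁, …, x_N`, has homogeneous degree at most `k`: it is a
linear combination of monomials `x^J` with `∑ d_i J_i ≤ k`. -/
def HomDegreeLE (P : MvPolynomial (Fin N) ℝ) (k : ℕ) : Prop :=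
  ∀ J ∈ P.support, 𝔾.homNorm (fun i ↦ J i) ≤ k

end CarnotGroup

/-- The function on `ℝ^N` given by a polynomial. -/
def polyFun {N : ℕ} (P : MvPolynomial (Fin N) ℝ) (x : RN N) : ℝ :=
  MvPolynomial.eval (fun i ↦ x i) P

end

/-! Left translation by `x₀` and the dilation `δ_r` reduce the estimate to unit scale. Put `Φ(z) =
x₀ · δ_r z`. Its Jacobian is `r^Q`, the preimage of `E` has measure at least `A` and lies in a fixed
box, and `P ∘ Φ` is again a polynomial of homogeneous degree at most `k`. Such polynomials form a
finite-dimensional space, so compactness of the unit sphere of coefficients bounds every coefficient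
of `P ∘ Φ` by its `L¹` norm on the preimage, uniformly in the set (`exists_coeff_le_integral`). By
left invariance, `X^α P(x₀)` is `X^α` of the translated polynomial at the identity, where only the
coefficients of weight `|α|` count (`exists_iterDeriv_le`). Undoing the dilation divides these by
`r^|α|`, and the Jacobian contributes `r^(-Q)`.

The geometric input is that the components of the `X_j` are homogeneous polynomials. It is derived
without an explicit group law. In exponential coordinates the field with value `x` at the identity
equals `x` along the whole ray through `x` (`leftField_ray`). The Maurer–Cartan equation then
becomes a linear equation along rays (`hasDerivAt_coframe_ray`), and it is solved weight by weight
because the bracket respects the grading (`exists_coframe_poly`). Inverting the unitriangular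
coframe gives the fields (`exists_field_poly`). Three consequences follow: translations have
determinant one (`det_fderiv_mul`), they preserve the weighted degree (`exists_translate`), and
balls lie in translated anisotropic boxes (`exists_ball_subset_box`). -/

noncomputable section

/-! ### Polynomials graded by integer weights, and integration along rays -/

section WeightedPolynomials

open MvPolynomial

variable {N : ℕ}

/-- The polynomials all of whose monomials have weight in `s`. -/
def polyWt (w : Fin N → ℤ) (s : Set ℤ) : Submodule ℝ (MvPolynomial (Fin N) ℝ) :=
  restrictSupport ℝ {J | ∑ i, w i * (J i : ℤ) ∈ s}

variable {w : Fin N → ℤ} {s t u : Set ℤ} {p q : MvPolynomial (Fin N) ℝ}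

lemma mem_polyWt : p ∈ polyWt w s ↔ ∀ J, coeff J p ≠ 0 → ∑ i, w i * (J i : ℤ) ∈ s := by
  simp only [polyWt, mem_restrictSupport_iff, Set.subset_def, Finset.mem_coe, mem_support_iff,
    mem_ofPred_eq]

lemma monomial_mem_polyWt {J : Fin N →₀ ℕ} (c : ℝ) (h : ∑ i, w i * (J i : ℤ) ∈ s) :
    monomial J c ∈ polyWt w s := by
  refine mem_polyWt.2 fun J' hJ' ↦ ?_
  rw [coeff_monomial] at hJ'
  split_ifs at hJ' with hh
  · rwa [← hh]
  · exact absurd rfl hJ'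

lemma C_mem_polyWt (c : ℝ) (h : 0 ∈ s) : C c ∈ polyWt w s :=
  monomial_mem_polyWt c (by simpa using h)

lemma X_mem_polyWt (i : Fin N) (h : w i ∈ s) : (X i : MvPolynomial (Fin N) ℝ) ∈ polyWt w s :=
  monomial_mem_polyWt 1 (by
    classical
    have : ∑ l, w l * ((Finsupp.single i 1 : Fin N →₀ ℕ) l : ℤ) = w i := by
      simp [Finsupp.single_apply]
    rwa [this])

lemma mul_mem_polyWt (hp : p ∈ polyWt w s) (hq : q ∈ polyWt w t)
    (h : ∀ a ∈ s, ∀ b ∈ t, a + b ∈ u) : p * q ∈ polyWt w u := by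
  classical
  refine mem_polyWt.2 fun J hJ ↦ ?_
  rw [coeff_mul] at hJ
  obtain ⟨x, hx, hne⟩ := Finset.exists_ne_zero_of_sum_ne_zero hJ
  replace hx : x.1 + x.2 = J := Finset.HasAntidiagonal.mem_antidiagonal.1 hx
  have h1 := mem_polyWt.1 hp x.1 (left_ne_zero_of_mul hne)
  have h2 := mem_polyWt.1 hq x.2 (right_ne_zero_of_mul hne)
  have := h _ h1 _ h2
  rw [← Finset.sum_add_distrib] at this
  simpa [← hx, mul_add] using this

lemma pderiv_mem_polyWt {i : Fin N} (hp : p ∈ polyWt w s) (h : ∀ a ∈ s, a - w i ∈ t) :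
    pderiv i p ∈ polyWt w t := by
  classical
  rw [p.as_sum, map_sum]
  refine Submodule.sum_mem _ fun J hJ ↦ ?_
  rw [pderiv_monomial]
  by_cases h0 : J i = 0
  · simp [h0]
  refine monomial_mem_polyWt _ ?_
  have h1 := h _ (mem_polyWt.1 hp J (mem_support_iff.1 hJ))
  convert h1 using 1
  have : ∀ l, w l * ((J - Finsupp.single i 1 : Fin N →₀ ℕ) l : ℤ) =
      w l * (J l : ℤ) - if l = i then w i else 0 := by
    intro l
    by_cases hl : l = i
    · subst hl
      have : ((J l - 1 : ℕ) : ℤ) = (J l : ℤ) - 1 := by omega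
      simp [this, mul_sub]
    · simp [hl]
  rw [Finset.sum_congr rfl fun l _ ↦ this l, Finset.sum_sub_distrib]
  simp

lemma polyWt_eq_zero (hw : ∀ i, 0 < w i) (hs : ∀ a ∈ s, a < 0) (hp : p ∈ polyWt w s) : p = 0 := by
  ext J
  rw [coeff_zero]
  by_contra h
  have h1 := hs _ (mem_polyWt.1 hp J h)
  have : 0 ≤ ∑ i, w i * (J i : ℤ) :=
    Finset.sum_nonneg fun i _ ↦ mul_nonneg (hw i).le (Int.natCast_nonneg _)
  omega

lemma polyWt_eq_const (hw : ∀ i, 0 < w i) (hs : ∀ a ∈ s, a ≤ 0) (hp : p ∈ polyWt w s) :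
    p = C (coeff 0 p) := by
  classical
  ext J
  rw [coeff_C]
  split_ifs with h
  · rw [← h]
  by_contra hne
  have h1 := hs _ (mem_polyWt.1 hp J hne)
  obtain ⟨i, hi⟩ : ∃ i, J i ≠ 0 := by
    by_contra! hh
    exact h (Finsupp.ext fun i ↦ (hh i).symm)
  have : 0 < ∑ i, w i * (J i : ℤ) := by
    refine Finset.sum_pos' (fun i _ ↦ mul_nonneg (hw i).le (Int.natCast_nonneg _))
      ⟨i, Finset.mem_univ _, mul_pos (hw i) (by omega)⟩
  omega

@[simp] lemma polyFun_add (x : RN N) : polyFun (p + q) x = polyFun p x + polyFun q x := by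
  simp [polyFun]

@[simp] lemma polyFun_mul (x : RN N) : polyFun (p * q) x = polyFun p x * polyFun q x := by
  simp [polyFun]

@[simp] lemma polyFun_sub (x : RN N) : polyFun (p - q) x = polyFun p x - polyFun q x := by
  simp [polyFun]

@[simp] lemma polyFun_zero (x : RN N) : polyFun 0 x = 0 := by simp [polyFun]

@[simp] lemma polyFun_C (c : ℝ) (x : RN N) : polyFun (C c) x = c := by simp [polyFun]

@[simp] lemma polyFun_X (i : Fin N) (x : RN N) : polyFun (X i) x = x i := by simp [polyFun]

@[simp] lemma polyFun_sum {ι : Type*} (S : Finset ι) (f : ι → MvPolynomial (Fin N) ℝ) (x : RN N) :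
    polyFun (∑ i ∈ S, f i) x = ∑ i ∈ S, polyFun (f i) x := by
  simp [polyFun]

lemma polyFun_monomial (J : Fin N →₀ ℕ) (c : ℝ) (x : RN N) :
    polyFun (monomial J c) x = c * ∏ i, x i ^ J i := by
  simp [polyFun, eval_monomial, Finsupp.prod_fintype]

lemma polyFun_at_zero : polyFun p (0 : RN N) = coeff 0 p := by
  rw [polyFun, ← constantCoeff_eq, ← eval_zero]
  rfl

lemma polyFun_eq_sum (p : MvPolynomial (Fin N) ℝ) (x : RN N) :
    polyFun p x = ∑ J ∈ p.support, coeff J p * ∏ i, x i ^ J i := by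
  conv_lhs => rw [p.as_sum, polyFun_sum]
  simp only [polyFun_monomial]

lemma hasFDerivAt_polyFun (p : MvPolynomial (Fin N) ℝ) (x : RN N) :
    HasFDerivAt (polyFun p)
      (∑ i, polyFun (pderiv i p) x • (EuclideanSpace.proj i : RN N →L[ℝ] ℝ)) x := by
  classical
  induction p using MvPolynomial.induction_on with
  | C a =>
    have : polyFun (C a : MvPolynomial (Fin N) ℝ) = fun _ ↦ a := by ext; simp
    rw [this]
    simpa using hasFDerivAt_const a x
  | add p q hp hq =>
    have : polyFun (p + q) = fun x ↦ polyFun p x + polyFun q x := by ext; simp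
    rw [this]
    convert! hp.add hq using 1
    simp [add_smul, Finset.sum_add_distrib]
  | mul_X p i hp =>
    have : polyFun (p * X i) = fun x ↦ polyFun p x * (EuclideanSpace.proj i : RN N →L[ℝ] ℝ) x := by
      ext; simp
    rw [this]
    convert! hp.mul (EuclideanSpace.proj i : RN N →L[ℝ] ℝ).hasFDerivAt using 1
    ext v
    simp only [Derivation.leibniz, pderiv_X, smul_eq_mul, polyFun_add, polyFun_mul, polyFun_X]
    simp [add_mul, Finset.sum_add_distrib, Finset.mul_sum, Pi.single_apply, apply_ite polyFun,
      ite_apply]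
    simp [polyFun, mul_assoc]

lemma contDiff_polyFun (p : MvPolynomial (Fin N) ℝ) : ContDiff ℝ ∞ (polyFun p) := by
  have : polyFun p = fun x : RN N ↦ ∑ J ∈ p.support, coeff J p * ∏ i, x i ^ J i :=
    funext (polyFun_eq_sum p)
  rw [this]
  fun_prop

lemma differentiable_polyFun (p : MvPolynomial (Fin N) ℝ) : Differentiable ℝ (polyFun p) :=
  fun x ↦ (hasFDerivAt_polyFun p x).differentiableAt

lemma continuous_polyFun (p : MvPolynomial (Fin N) ℝ) : Continuous (polyFun p) :=
  (contDiff_polyFun p).continuous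

lemma fderiv_polyFun (p : MvPolynomial (Fin N) ℝ) (x v : RN N) :
    fderiv ℝ (polyFun p) x v = ∑ i, v i * polyFun (pderiv i p) x := by
  rw [(hasFDerivAt_polyFun p x).fderiv]
  simp [mul_comm]

/-- The radial primitive `x ↦ ∫₀¹ h(t x) dt` of a polynomial `h`. -/
def radialPrim (h : MvPolynomial (Fin N) ℝ) : MvPolynomial (Fin N) ℝ :=
  ∑ J ∈ h.support, monomial J (coeff J h / ((∑ i, J i : ℕ) + 1))

lemma radialPrim_mem_polyWt (hp : p ∈ polyWt w s) : radialPrim p ∈ polyWt w s :=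
  Submodule.sum_mem _ fun J hJ ↦ monomial_mem_polyWt _ (mem_polyWt.1 hp J (mem_support_iff.1 hJ))

/-- On a monomial of ordinary degree `n` the extra factor `t` produces `t^(n+1)`, whose derivative
cancels the divisor `n + 1`. Integration along rays thus stays within polynomials and keeps the
weights. -/
lemma hasDerivAt_radialPrim (h : MvPolynomial (Fin N) ℝ) (x : RN N) (t : ℝ) :
    HasDerivAt (fun t : ℝ ↦ t * polyFun (radialPrim h) (t • x)) (polyFun h (t • x)) t := by
  have h1 : (fun t : ℝ ↦ t * polyFun (radialPrim h) (t • x)) = fun t ↦ ∑ J ∈ h.support,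
      (coeff J h / ((∑ i, J i : ℕ) + 1) * ∏ i, x i ^ J i) * t ^ (∑ i, J i + 1) := by
    ext t
    rw [radialPrim, polyFun_sum, Finset.mul_sum]
    refine Finset.sum_congr rfl fun J _ ↦ ?_
    simp only [polyFun_monomial, PiLp.smul_apply, smul_eq_mul, mul_pow, Finset.prod_mul_distrib,
      Finset.prod_pow_eq_pow_sum]
    ring
  rw [h1, polyFun_eq_sum]
  refine HasDerivAt.fun_sum fun J _ ↦ ?_
  have h2 := (hasDerivAt_pow (∑ i, J i + 1) t).const_mul
    (coeff J h / ((∑ i, J i : ℕ) + 1) * ∏ i, x i ^ J i)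
  convert! h2 using 1
  simp only [PiLp.smul_apply, smul_eq_mul, mul_pow, Finset.prod_mul_distrib,
      Finset.prod_pow_eq_pow_sum]
  have : ((∑ i, J i : ℕ) : ℝ) + 1 ≠ 0 := by positivity
  push_cast at this ⊢
  field_simp

lemma eq_radialPrim {φ : ℝ → ℝ} {h : MvPolynomial (Fin N) ℝ} {x : RN N}
    (hφ : ∀ t, HasDerivAt φ (polyFun h (t • x)) t) :
    φ 1 = φ 0 + polyFun (radialPrim h) x := by
  have h1 : ∀ t, HasDerivAt (fun t ↦ φ t - t * polyFun (radialPrim h) (t • x)) 0 t := fun t ↦ by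
    simpa using (hφ t).fun_sub (hasDerivAt_radialPrim h x t)
  have h2 := is_const_of_deriv_eq_zero (fun t ↦ (h1 t).differentiableAt) (fun t ↦ (h1 t).deriv) 1 0
  simp at h2
  linarith

/-- A variable of weight above `n` cannot occur in a polynomial of weight `n`, so only the lower
coordinates need a bound. This is what lets horizontal curves be estimated layer by layer. -/
lemma exists_bound_polyFun_of_homogeneous {d : Fin N → ℕ} {n : ℕ}
    (hp : p ∈ polyWt (fun i ↦ (d i : ℤ)) {(n : ℤ)}) {K : ℝ} (hK : 0 ≤ K) :
    ∃ C : ℝ, 0 ≤ C ∧ ∀ R : ℝ, 0 ≤ R → ∀ z : RN N, (∀ i, d i ≤ n → |z i| ≤ K * R ^ d i) →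
      (∀ i, 0 < d i) → |polyFun p z| ≤ C * R ^ n := by
  refine ⟨∑ J ∈ p.support, |coeff J p| * K ^ (∑ i, J i), by positivity, fun R hR z hz hd ↦ ?_⟩
  rw [polyFun_eq_sum, Finset.sum_mul]
  refine (Finset.abs_sum_le_sum_abs _ _).trans (Finset.sum_le_sum fun J hJ ↦ ?_)
  have hwt : ∑ i, d i * J i = n := by
    have := mem_polyWt.1 hp J (mem_support_iff.1 hJ)
    rw [mem_singleton_iff] at this
    exact_mod_cast this
  rw [abs_mul, mul_assoc, Finset.abs_prod]
  gcongr
  calc ∏ i, |z i ^ J i| ≤ ∏ i, (K * R ^ d i) ^ J i := by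
        refine Finset.prod_le_prod (fun i _ ↦ abs_nonneg _) fun i _ ↦ ?_
        rw [abs_pow]
        by_cases h0 : J i = 0
        · simp [h0]
        have : d i ≤ n := by
          calc d i ≤ d i * J i := Nat.le_mul_of_pos_right _ (Nat.pos_of_ne_zero h0)
            _ ≤ ∑ i, d i * J i :=
              Finset.single_le_sum (f := fun i ↦ d i * J i) (fun _ _ ↦ Nat.zero_le _)
                (Finset.mem_univ i)
            _ = n := hwt
        exact pow_le_pow_left₀ (abs_nonneg _) (hz i this) _
    _ = K ^ (∑ i, J i) * R ^ n := by
        simp only [mul_pow, Finset.prod_mul_distrib, Finset.prod_pow_eq_pow_sum, ← pow_mul, hwt]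

end WeightedPolynomials

/-! ### Zero sets of polynomials, and coefficients controlled by integrals -/

section PolynomialIntegrals

open MvPolynomial Filter Topology

variable {N : ℕ}

lemma exists_polynomial_line (p : MvPolynomial (Fin N) ℝ) (y v : RN N) :
    ∃ q : Polynomial ℝ, ∀ t, q.eval t = polyFun p (y + t • v) := by
  refine ⟨aeval (fun i ↦ Polynomial.C (y i) + Polynomial.C (v i) * Polynomial.X) p, fun t ↦ ?_⟩
  induction p using MvPolynomial.induction_on with
  | C a => simp
  | add p q hp hq => simp [hp, hq]
  | mul_X p i hp => simp [hp, mul_comm t]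

/-- Induction on the ordinary degree: some partial derivative is a nonzero polynomial of lower
degree, hence nonzero almost everywhere, and where it is nonzero the zeros of `p` are thin in that
direction. -/
lemma ae_polyFun_ne_zero {p : MvPolynomial (Fin N) ℝ} (hp : p ≠ 0) :
    ∀ᵐ x : RN N, polyFun p x ≠ 0 := by
  classical
  obtain ⟨n, hn⟩ : ∃ n : ℕ, p ∈ polyWt (fun _ ↦ 1) {a | a < (n : ℤ)} := by
    refine ⟨p.totalDegree + 1, mem_polyWt.2 fun J hJ ↦ ?_⟩
    have h := le_totalDegree (mem_support_iff.2 hJ)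
    rw [Finsupp.sum_fintype _ _ (fun _ ↦ rfl)] at h
    have h' : ((∑ i, J i : ℕ) : ℤ) ≤ p.totalDegree := by exact_mod_cast h
    push_cast at h'
    simp only [one_mul, mem_ofPred_eq, Nat.cast_add, Nat.cast_one]
    omega
  induction n generalizing p with
  | zero => exact absurd (polyWt_eq_zero (by simp) (by simp) hn) hp
  | succ n ih =>
    by_cases hd : ∀ i, pderiv i p = 0
    · have hC : p = C (coeff 0 p) := by
        ext J
        rw [coeff_C]
        split_ifs with h0
        · rw [← h0]
        by_contra hne
        obtain ⟨i, hi⟩ : ∃ i, J i ≠ 0 := by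
          by_contra! hh
          exact h0 (Finsupp.ext fun i ↦ (hh i).symm)
        have h1 := coeff_pderiv (i := i) p (J - Finsupp.single i 1)
        have h2 : J - Finsupp.single i 1 + Finsupp.single i 1 = J :=
          tsub_add_cancel_of_le (Finsupp.single_le_iff.2 (Nat.one_le_iff_ne_zero.2 hi))
        rw [hd i, coeff_zero, h2] at h1
        rcases mul_eq_zero.1 h1.symm with h3 | h3
        · exact hne h3
        · norm_cast at h3
      have hc : coeff 0 p ≠ 0 := fun h ↦ hp (by rw [hC, h, C_0])
      refine Filter.Eventually.of_forall fun x ↦ ?_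
      rw [hC]
      simpa using hc
    · push Not at hd
      obtain ⟨i, hi⟩ := hd
      have h1 : ∀ᵐ x : RN N, polyFun (pderiv i p) x ≠ 0 :=
        ih hi (pderiv_mem_polyWt hn fun a ha ↦ by
          simp only [mem_ofPred_eq, Nat.cast_add, Nat.cast_one] at ha ⊢
          omega)
      let e : RN N := EuclideanSpace.single i 1
      -- Fubini along lines parallel to `e`: if `p` vanishes on the whole line, so does its `i`-th
      -- derivative and the set misses the line; otherwise the line meets the set in finitely many
      -- roots.
      have h2 : ∀ᵐ x : RN N, x ∈ {x | polyFun p x = 0 ∧ polyFun (pderiv i p) x ≠ 0}ᶜ := by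
        refine ae_mem_of_ae_add_linearMap_mem (𝕜 := ℝ) (LinearMap.toSpanSingleton ℝ (RN N) e)
          volume volume ?_ fun y ↦ ?_
        · refine (MeasurableSet.inter ?_ ?_).compl
          · exact (isClosed_singleton.preimage (continuous_polyFun p)).measurableSet
          · exact (isOpen_compl_singleton.preimage (continuous_polyFun _)).measurableSet
        obtain ⟨q, hq⟩ := exists_polynomial_line p y e
        by_cases hq0 : q = 0
        · refine Filter.Eventually.of_forall fun t ht ↦ ht.2 ?_
          have h3 : HasDerivAt (fun t : ℝ ↦ polyFun p (y + t • e))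
              (fderiv ℝ (polyFun p) (y + t • e) e) t := by
            have h : HasDerivAt (fun t : ℝ ↦ y + t • e) e t := by
              simpa using ((hasDerivAt_id t).smul_const e).const_add y
            exact (differentiable_polyFun p (y + t • e)).hasFDerivAt.comp_hasDerivAt t h
          have h4 : (fun t : ℝ ↦ polyFun p (y + t • e)) = fun _ ↦ 0 := by
            ext t
            rw [← hq, hq0, Polynomial.eval_zero]
          rw [h4] at h3
          have h5 := h3.unique (hasDerivAt_const t (0 : ℝ))
          rw [fderiv_polyFun] at h5
          simpa [e, Pi.single_apply] using h5
        · have : ∀ᵐ t : ℝ, t ∈ (↑q.roots.toFinset : Set ℝ)ᶜ :=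
            compl_mem_ae_iff.2 ((Finset.finite_toSet _).measure_zero volume)
          filter_upwards [this] with t ht hh
          refine ht ?_
          simp only [Finset.mem_coe, Multiset.mem_toFinset, Polynomial.mem_roots hq0,
            Polynomial.IsRoot]
          rw [hq]
          exact hh.1
      filter_upwards [h1, h2] with x hx1 hx2 hx3
      exact hx2 ⟨hx3, hx1⟩

lemma isCompact_box (K : ℝ) : IsCompact {x : RN N | ∀ i, |x i| ≤ K} := by
  have h : {x : RN N | ∀ i, |x i| ≤ K} =
      (EuclideanSpace.equiv (Fin N) ℝ).toHomeomorph ⁻¹' (Set.pi univ fun _ ↦ Icc (-K) K) := by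
    ext x
    simp [abs_le, Pi.le_def, forall_and]
  rw [h, Homeomorph.isCompact_preimage]
  exact isCompact_univ_pi fun _ ↦ isCompact_Icc

lemma integrableOn_polyFun_of_subset_box (p : MvPolynomial (Fin N) ℝ) {K : ℝ} {E : Set (RN N)}
    (hE : E ⊆ {x | ∀ i, |x i| ≤ K}) : IntegrableOn (fun x ↦ |polyFun p x|) E :=
  ((continuous_polyFun p).abs.continuousOn.integrableOn_compact (isCompact_box K)).mono_set hE

/-- Where a polynomial is nonzero it is bounded away from zero off a set of small measure. -/
lemma exists_volume_small_lt {p : MvPolynomial (Fin N) ℝ} (hp : p ≠ 0) (K : ℝ) {A : ℝ}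
    (hA : 0 < A) :
    ∃ ε : ℝ, 0 < ε ∧
      volume ({x : RN N | |polyFun p x| ≤ ε} ∩ {x | ∀ i, |x i| ≤ K}) < ENNReal.ofReal A := by
  let Z : ℕ → Set (RN N) := fun n ↦ {x | |polyFun p x| ≤ 1 / ((n : ℝ) + 1)} ∩ {x | ∀ i, |x i| ≤ K}
  have hmeas : ∀ n, MeasurableSet (Z n) := fun n ↦
    (isClosed_le (continuous_polyFun p).abs continuous_const).measurableSet.inter
      (isCompact_box K).isClosed.measurableSet
  have hanti : Antitone Z := fun m n hmn x hx ↦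
    by
    have h : (m : ℝ) ≤ n := by exact_mod_cast hmn
    exact ⟨le_trans (show |polyFun p x| ≤ 1 / ((n : ℝ) + 1) from hx.1)
      (one_div_le_one_div_of_le (by positivity) (by linarith)), hx.2⟩
  -- The sets decrease to the zero set of `p` in the box. The finite volume of the box permits
  -- continuity from above.
  have hzero : volume (⋂ n, Z n) = 0 := by
    refine measure_mono_null (fun x hx ↦ ?_) (ae_polyFun_ne_zero hp)
    rw [mem_iInter] at hx
    have h1 : |polyFun p x| ≤ 0 :=
      ge_of_tendsto' tendsto_one_div_add_atTop_nhds_zero_nat fun n ↦ (hx n).1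
    simpa using h1
  have hlim := tendsto_measure_iInter_atTop (μ := volume) (fun n ↦ (hmeas n).nullMeasurableSet)
    hanti ⟨0, (measure_mono inter_subset_right).trans_lt (isCompact_box K).measure_lt_top |>.ne⟩
  rw [hzero] at hlim
  obtain ⟨n, hn⟩ := (hlim.eventually (gt_mem_nhds (ENNReal.ofReal_pos.2 hA))).exists
  exact ⟨1 / ((n : ℝ) + 1), by positivity, hn⟩

/-- On subsets of a box of measure bounded below, the `L¹` norm controls the coefficients of
polynomials with monomials in a fixed finite set. -/
lemma exists_coeff_le_integral (S : Finset (Fin N →₀ ℕ)) (K : ℝ) {A : ℝ} (hA : 0 < A) :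
    ∃ C : ℝ, 0 < C ∧ ∀ p : MvPolynomial (Fin N) ℝ, p.support ⊆ S → ∀ E : Set (RN N),
      MeasurableSet E → E ⊆ {x | ∀ i, |x i| ≤ K} → ENNReal.ofReal A ≤ volume E →
      ∀ J, |coeff J p| ≤ C * ∫ x in E, |polyFun p x| := by
  classical
  let P : (S → ℝ) → MvPolynomial (Fin N) ℝ := fun c ↦ ∑ J : S, monomial J.1 (c J)
  have hPcoeff : ∀ c (J : S), coeff J.1 (P c) = c J := by
    intro c J
    simp only [P, coeff_sum, coeff_monomial]
    rw [Finset.sum_eq_single J]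
    · simp
    · intro J' _ h
      rw [if_neg fun hh ↦ h (Subtype.ext hh)]
    · simp
  have hPfun : ∀ c x, polyFun (P c) x = ∑ J : S, c J * ∏ i, x i ^ J.1 i := by
    intro c x
    simp [P, polyFun_monomial]
  let m : RN N → ℝ := fun x ↦ ∑ J : S, |∏ i, x i ^ J.1 i|
  have hm : Continuous m := by fun_prop
  obtain ⟨M, hM⟩ := (isCompact_box (N := N) K).exists_bound_of_continuousOn hm.continuousOn
  have hdiff : ∀ c c' x, (∀ i, |x i| ≤ K) →
      |polyFun (P c) x - polyFun (P c') x| ≤ ‖c - c'‖ * |M| := by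
    intro c c' x hx
    rw [hPfun, hPfun, ← Finset.sum_sub_distrib]
    calc |∑ J : S, (c J * ∏ i, x i ^ J.1 i - c' J * ∏ i, x i ^ J.1 i)|
        ≤ ∑ J : S, ‖c - c'‖ * |∏ i, x i ^ J.1 i| := by
          refine (Finset.abs_sum_le_sum_abs _ _).trans (Finset.sum_le_sum fun J _ ↦ ?_)
          rw [← sub_mul, abs_mul]
          gcongr
          exact norm_le_pi_norm (c - c') J
      _ = ‖c - c'‖ * m x := by rw [Finset.mul_sum]
      _ ≤ ‖c - c'‖ * |M| := by
          gcongr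
          exact (le_abs_self _).trans ((hM x hx).trans (le_abs_self _))
  -- A lower bound uniform in `E` is found near each point of the unit sphere; compactness makes it
  -- uniform in `c`.
  obtain ⟨δ, hδ, hsphere⟩ : ∃ δ : ℝ, 0 < δ ∧ ∀ c ∈ Metric.sphere (0 : S → ℝ) 1, ∀ E : Set (RN N),
      MeasurableSet E → E ⊆ {x | ∀ i, |x i| ≤ K} → ENNReal.ofReal A ≤ volume E →
      δ ≤ ∫ x in E, |polyFun (P c) x| := by
    refine (isCompact_sphere (0 : S → ℝ) 1).induction_on
      (p := fun s ↦ ∃ δ : ℝ, 0 < δ ∧ ∀ c ∈ s, ∀ E : Set (RN N),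
      MeasurableSet E → E ⊆ {x | ∀ i, |x i| ≤ K} → ENNReal.ofReal A ≤ volume E →
      δ ≤ ∫ x in E, |polyFun (P c) x|) ⟨1, one_pos, by simp⟩ ?_ ?_ ?_
    · rintro s t hst ⟨δ, hδ, h⟩
      exact ⟨δ, hδ, fun c hc ↦ h c (hst hc)⟩
    · rintro s t ⟨δ, hδ, h⟩ ⟨δ', hδ', h'⟩
      refine ⟨min δ δ', lt_min hδ hδ', fun c hc E h1 h2 h3 ↦ ?_⟩
      rcases hc with hc | hc
      · exact (min_le_left _ _).trans (h c hc E h1 h2 h3)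
      · exact (min_le_right _ _).trans (h' c hc E h1 h2 h3)
    · intro c hc
      have hc0 : P c ≠ 0 := by
        intro h0
        have : c = 0 := by
          ext J
          rw [← hPcoeff c J, h0]
          simp
        rw [this] at hc
        simp at hc
      -- Removing the set where the polynomial is at most `ε` costs less than half of the measure
      -- `A`. Nearby coefficients change values on the box by less than `ε / 2`, which leaves at
      -- least `ε / 2` on a set of measure at least `A / 2`.
      obtain ⟨ε, hε, hsmall⟩ := exists_volume_small_lt hc0 K (half_pos hA)
      refine ⟨{c' | ‖c - c'‖ * |M| < ε / 2}, mem_nhdsWithin_of_mem_nhds ?_, ε / 2 * (A / 2),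
        by positivity, fun c' hc' E hE hEK hAE ↦ ?_⟩
      · refine (isOpen_lt (by fun_prop) continuous_const).mem_nhds ?_
        simp only [mem_ofPred_eq, sub_self, norm_zero, zero_mul]
        positivity
      let Z := {x : RN N | |polyFun (P c) x| ≤ ε} ∩ {x | ∀ i, |x i| ≤ K}
      have hZ : MeasurableSet Z :=
        (isClosed_le (continuous_polyFun _).abs continuous_const).measurableSet.inter
        (isCompact_box K).isClosed.measurableSet
      have hfin : volume (E \ Z) ≠ ⊤ :=
        ((measure_mono (sdiff_subset.trans hEK)).trans_lt (isCompact_box K).measure_lt_top).ne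
      have hvol : A / 2 ≤ volume.real (E \ Z) := by
        rw [Measure.real, ← ENNReal.ofReal_le_iff_le_toReal hfin]
        have h1 : ENNReal.ofReal A ≤ volume (E \ Z) + ENNReal.ofReal (A / 2) := by
          refine hAE.trans ((measure_mono (t := (E \ Z) ∪ Z) ?_).trans
            ((measure_union_le _ _).trans (by gcongr)))
          intro x hx
          by_cases hxZ : x ∈ Z
          · exact Or.inr hxZ
          · exact Or.inl ⟨hx, hxZ⟩
        have h2 : ENNReal.ofReal A = ENNReal.ofReal (A / 2) + ENNReal.ofReal (A / 2) := by
          rw [← ENNReal.ofReal_add (by positivity) (by positivity), add_halves]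
        rw [h2] at h1
        exact (ENNReal.add_le_add_iff_right ENNReal.ofReal_ne_top).1 h1
      calc ε / 2 * (A / 2) ≤ ε / 2 * volume.real (E \ Z) := by gcongr
        _ = ∫ x in E \ Z, ε / 2 := by simp [mul_comm]
        _ ≤ ∫ x in E \ Z, |polyFun (P c') x| := by
          refine setIntegral_mono_on (integrableOn_const hfin)
            (integrableOn_polyFun_of_subset_box _ (sdiff_subset.trans hEK)) (hE.diff hZ)
            fun x hx ↦ ?_
          have h1 : ε < |polyFun (P c) x| := by
            by_contra! h
            exact hx.2 ⟨h, hEK hx.1⟩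
          have h2 := hdiff c c' x (hEK hx.1)
          have h3 := abs_sub_abs_le_abs_sub (polyFun (P c) x) (polyFun (P c') x)
          have h4 : ‖c - c'‖ * |M| < ε / 2 := hc'
          linarith
        _ ≤ ∫ x in E, |polyFun (P c') x| :=
          setIntegral_mono_set (integrableOn_polyFun_of_subset_box _ hEK)
            (Filter.Eventually.of_forall fun x ↦ abs_nonneg _) sdiff_subset.eventuallyLE
  refine ⟨δ⁻¹, inv_pos.2 hδ, fun p hp E hE hEK hAE J ↦ ?_⟩
  let c : S → ℝ := fun J ↦ coeff J.1 p
  have hpc : P c = p := by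
    conv_rhs => rw [p.as_sum]
    simp only [P, c]
    rw [Finset.sum_coe_sort S fun J ↦ monomial J (coeff J p)]
    refine (Finset.sum_subset hp fun J _ hJ ↦ ?_).symm
    rw [notMem_support_iff.1 hJ, monomial_zero]
  have hJc : |coeff J p| ≤ ‖c‖ := by
    by_cases hJ : J ∈ S
    · exact norm_le_pi_norm c ⟨J, hJ⟩
    · rw [notMem_support_iff.1 fun h ↦ hJ (hp h), abs_zero]
      exact norm_nonneg _
  refine hJc.trans ?_
  by_cases hc : ‖c‖ = 0
  · rw [hc]
    exact mul_nonneg (inv_nonneg.2 hδ.le) (integral_nonneg fun x ↦ abs_nonneg _)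
  have hcpos : 0 < ‖c‖ := lt_of_le_of_ne (norm_nonneg _) (Ne.symm hc)
  have h1 := hsphere (‖c‖⁻¹ • c) (by simp [norm_smul, hc]) E hE hEK hAE
  have h2 : ∀ x, |polyFun (P (‖c‖⁻¹ • c)) x| = ‖c‖⁻¹ * |polyFun p x| := by
    intro x
    rw [← hpc, hPfun, hPfun, ← abs_of_pos (inv_pos.2 hcpos), ← abs_mul, Finset.mul_sum,
      abs_of_pos (inv_pos.2 hcpos)]
    simp [mul_assoc]
  simp only [h2, integral_const_mul] at h1
  rw [inv_mul_eq_div, le_div_iff₀ hcpos] at h1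
  rw [inv_mul_eq_div, le_div_iff₀ hδ]
  linarith

end PolynomialIntegrals

/-! ### Left invariant fields in exponential coordinates -/

section LieGroupOnRN

variable {N : ℕ} [Group (RN N)]

/-- The left invariant vector field with value `v` at the identity, as a map of `ℝ^N`. -/
def leftField (v x : RN N) : RN N := mulInvariantVectorField (I := 𝓘(ℝ, RN N)) (G := RN N) v x

/-- The bracket of the Lie algebra, read on `ℝ^N`. -/
def lieBr (v w : RN N) : RN N :=
  Bracket.bracket (L := LieAlg N) (M := LieAlg N) v w

lemma leftField_eq (v x : RN N) : leftField v x = fderiv ℝ (fun y ↦ x * y) 1 v := by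
  rw [← mfderiv_eq_fderiv]
  rfl

lemma leftField_smul (c : ℝ) (v x : RN N) : leftField (c • v) x = c • leftField v x := by
  simp [leftField_eq]

lemma leftField_one (v : RN N) : leftField v 1 = v := by
  have : (fun y : RN N ↦ 1 * y) = id := by ext1; simp
  rw [leftField_eq, this, fderiv_id]
  rfl

lemma hasDerivAt_of_isMIntegralCurve {v : RN N} {γ : ℝ → RN N}
    (hγ : IsMIntegralCurve (I := 𝓘(ℝ, RN N)) γ
      (mulInvariantVectorField (I := 𝓘(ℝ, RN N)) (G := RN N) v)) (t : ℝ) :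
    HasDerivAt γ (leftField v (γ t)) t := by
  have h : HasFDerivAt γ ((1 : ℝ →L[ℝ] ℝ).smulRight (leftField v (γ t))) t :=
    hasMFDerivAt_iff_hasFDerivAt.1 (hγ t)
  simpa using h.hasDerivAt

variable [LieGroup 𝓘(ℝ, RN N) ∞ (RN N)]

variable (N) in
lemma lieGroup_minSmoothness : LieGroup 𝓘(ℝ, RN N) (minSmoothness ℝ 3) (RN N) := by
  apply LieGroup.of_le (n := ∞)
  rw [minSmoothness_of_isRCLikeNormedField]
  exact WithTop.coe_le_coe.2 (le_top : (3 : ℕ∞) ≤ ⊤)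

variable (N) in
lemma contDiff_mul_RN : ContDiff ℝ ∞ (fun p : RN N × RN N ↦ p.1 * p.2) := by
  have := contMDiff_mul 𝓘(ℝ, RN N) ∞ (G := RN N)
  rw [← contMDiff_iff_contDiff, modelWithCornersSelf_prod, ← chartedSpaceSelf_prod]
  exact this

variable (N) in
lemma contDiff_inv_RN : ContDiff ℝ ∞ (fun p : RN N ↦ p⁻¹) :=
  (contMDiff_inv 𝓘(ℝ, RN N) ∞ (G := RN N)).contDiff

lemma contDiff_mul_left_RN (g : RN N) : ContDiff ℝ ∞ (fun y : RN N ↦ g * y) :=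
  (contDiff_mul_RN N).comp (contDiff_const.prodMk contDiff_id)

lemma differentiable_mul_left (g : RN N) : Differentiable ℝ (fun y : RN N ↦ g * y) :=
  (contDiff_mul_left_RN g).differentiable (by simp)

lemma leftField_mul (v g x : RN N) :
    leftField v (g * x) = fderiv ℝ (fun y ↦ g * y) x (leftField v x) := by
  have h : (fun y : RN N ↦ g * x * y) = (fun y ↦ g * y) ∘ (fun y ↦ x * y) := by
    ext1 y
    simp [mul_assoc]
  rw [leftField_eq, h, fderiv_comp _ (differentiable_mul_left g _) (differentiable_mul_left x _),
    leftField_eq, mul_one]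
  rfl

lemma contDiff_leftField (v : RN N) : ContDiff ℝ ∞ (leftField v) := by
  have h : leftField v = fun x ↦ fderiv ℝ (fun y ↦ x * y) 1 v := funext (leftField_eq v)
  rw [h]
  have := ContDiff.fderiv (𝕜 := ℝ) (n := ∞) (m := ∞) (f := fun x y : RN N ↦ x * y)
    (g := fun _ ↦ (1 : RN N)) (contDiff_mul_RN N) contDiff_const (by simp)
  exact this.clm_apply contDiff_const

lemma leftField_lieBr (v w x : RN N) :
    leftField (lieBr v w) x =
      fderiv ℝ (leftField w) x (leftField v x) - fderiv ℝ (leftField v) x (leftField w x) := by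
  have := lieGroup_minSmoothness N
  have h := congrFun (mulInvariantVector_mlieBracket (I := 𝓘(ℝ, RN N)) (G := RN N) v w) x
  have h2 : VectorField.mlieBracket 𝓘(ℝ, RN N) (leftField v) (leftField w) x =
      VectorField.lieBracket ℝ (leftField v) (leftField w) x := by
    rw [← VectorField.lieBracketWithin_univ]
    exact (congrFun VectorField.mlieBracketWithin_univ x).symm.trans
      (congrFun VectorField.mlieBracketWithin_eq_lieBracketWithin x)
  exact h.trans h2

lemma isMIntegralCurve_unique {v : LieAlg N} {γ γ' : ℝ → RN N}
    (hγ : IsMIntegralCurve (I := 𝓘(ℝ, RN N)) γ (mulInvariantVectorField v))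
    (hγ' : IsMIntegralCurve (I := 𝓘(ℝ, RN N)) γ' (mulInvariantVectorField v)) (h : γ 0 = γ' 0) :
    γ = γ' := by
  have := lieGroup_minSmoothness N
  refine isMIntegralCurve_Ioo_eq_of_contMDiff_boundaryless ?_ hγ hγ' h
  exact (contMDiff_mulInvariantVectorField v).of_le (by
    rw [minSmoothness_of_isRCLikeNormedField]; norm_num)

namespace CarnotGroup

/-- The time-one point of the flow of `t • v` is the time-`t` point of the flow of `v`, by
uniqueness of integral curves. Since the exponential is the identity in these coordinates,
one-parameter subgroups are straight rays. -/
lemma hasDerivAt_ray (𝔾 : CarnotGroup N) (x : RN N) (t : ℝ) :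
    HasDerivAt (fun t : ℝ ↦ t • x)
      (leftField (∑ i, x i • 𝔾.X i : LieAlg N) (t • x)) t := by
  obtain ⟨γ, h0, hγ, h1⟩ := 𝔾.exp_coord x
  have hray : γ = fun t ↦ t • x := by
    ext1 t
    obtain ⟨η, k0, hη, k1⟩ := 𝔾.exp_coord (t • x)
    have hsum : (∑ i, (t • x) i • 𝔾.X i : LieAlg N) = t • (∑ i, x i • 𝔾.X i : LieAlg N) := by
      rw [Finset.smul_sum]
      exact Finset.sum_congr rfl fun i _ ↦ by rw [smul_smul]; rfl
    rw [hsum, mulInvariantVectorField_smul] at hη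
    have hγ' := hγ.comp_mul t
    rw [← mulInvariantVectorField_smul] at hη hγ'
    have := isMIntegralCurve_unique hη hγ' (by simp [k0, h0])
    rw [← k1, this]
    simp
  have := hasDerivAt_of_isMIntegralCurve hγ t
  rwa [hray] at this

lemma one_eq_zero (𝔾 : CarnotGroup N) : (1 : RN N) = 0 := by
  obtain ⟨γ, h0, hγ, h1⟩ := 𝔾.exp_coord 0
  have hz : (∑ i, (0 : RN N) i • 𝔾.X i : LieAlg N) = 0 :=
    Finset.sum_eq_zero fun i _ ↦ zero_smul ℝ _
  have h2 : ∀ t, HasDerivAt γ 0 t := fun t ↦ by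
    have := hasDerivAt_of_isMIntegralCurve hγ t
    rw [hz] at this
    have h3 : leftField (0 : RN N) (γ t) = 0 := by simp [leftField_eq]
    rwa [← h3]
  rw [← h0, ← h1]
  exact is_const_of_deriv_eq_zero (fun t ↦ (h2 t).differentiableAt) (fun t ↦ (h2 t).deriv) 0 1

lemma sum_smul_basis (𝔾 : CarnotGroup N) (x : RN N) : (∑ i, x i • 𝔾.X i : LieAlg N) = x := by
  have h := (𝔾.hasDerivAt_ray x 0).unique (by simpa using (hasDerivAt_id (0 : ℝ)).smul_const x)
  rw [zero_smul, ← 𝔾.one_eq_zero] at h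
  exact (leftField_one _).symm.trans h

/-- The ray through `x` has constant velocity `x` and is an integral curve of this field. All later
use of the exponential coordinates rests on this identity and on `one_eq_zero` and `basis_eq`. -/
lemma leftField_ray (𝔾 : CarnotGroup N) (x : RN N) (t : ℝ) : leftField x (t • x) = x := by
  have h := (𝔾.hasDerivAt_ray x t).unique (by simpa using (hasDerivAt_id t).smul_const x)
  rwa [𝔾.sum_smul_basis x] at h

lemma basis_eq (𝔾 : CarnotGroup N) (i : Fin N) : 𝔾.X i = (EuclideanSpace.single i (1 : ℝ) : RN N) := by
  classical
  rw [← 𝔾.sum_smul_basis (EuclideanSpace.single i 1), Finset.sum_eq_single i]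
  · simp
  · intro j _ hj
    simp [hj]
  · simp

lemma repr_eq (𝔾 : CarnotGroup N) (v : RN N) (i : Fin N) : 𝔾.X.repr v i = v i := by
  classical
  have h := congrArg (fun u ↦ 𝔾.X.repr u i) (𝔾.sum_smul_basis v)
  simp only [map_sum, map_smul, Module.Basis.repr_self] at h
  rw [← h]
  simp [Finsupp.single_apply]

lemma field_eq (𝔾 : CarnotGroup N) (i : Fin N) (x : RN N) :
    𝔾.field i x = leftField (EuclideanSpace.single i (1 : ℝ)) x := by
  rw [← 𝔾.basis_eq i]
  rfl

lemma leftField_eq_sum (𝔾 : CarnotGroup N) (v x : RN N) :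
    leftField v x = ∑ i, v i • 𝔾.field i x := by
  have h : v = ∑ i, v i • (EuclideanSpace.single i (1 : ℝ) : RN N) := by
    ext j
    simp [Pi.single_apply]
  conv_lhs => rw [h]
  rw [leftField_eq, map_sum]
  refine Finset.sum_congr rfl fun i _ ↦ ?_
  rw [map_smul, ← leftField_eq, field_eq]

end CarnotGroup

end LieGroupOnRN

/-! ### The graded bracket, the coframe, and polynomial form of the fields -/

section Frame

variable {N : ℕ} [Group (RN N)] [LieGroup 𝓘(ℝ, RN N) ∞ (RN N)]

lemma lieBr_eq_sum (v w : RN N) :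
    lieBr v w = ∑ i, ∑ l, (v i * w l) •
      lieBr (EuclideanSpace.single i 1) (EuclideanSpace.single l 1) := by
  have := lieGroup_minSmoothness N
  let F : RN N →ₗ[ℝ] RN N →ₗ[ℝ] RN N := LinearMap.mk₂ ℝ lieBr
    (fun a b c ↦ add_lie (L := LieAlg N) (M := LieAlg N) a b c)
    (fun t a b ↦ smul_lie (L := LieAlg N) (M := LieAlg N) t a b)
    (fun a b c ↦ lie_add (L := LieAlg N) (M := LieAlg N) a b c)
    (fun t a b ↦ lie_smul (L := LieAlg N) (M := LieAlg N) t a b)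
  have hsum : ∀ v : RN N, v = ∑ i, v i • (EuclideanSpace.single i (1 : ℝ) : RN N) := by
    intro v
    ext j
    simp [Pi.single_apply]
  change F v w = ∑ i, ∑ l, (v i * w l) • F (EuclideanSpace.single i 1) (EuclideanSpace.single l 1)
  conv_lhs => rw [hsum v, hsum w]
  simp only [map_sum, LinearMap.sum_apply, map_smul, LinearMap.smul_apply, mul_smul,
    Finset.smul_sum]
  rw [Finset.sum_comm]
  exact Finset.sum_congr rfl fun i _ ↦ Finset.sum_congr rfl fun l _ ↦ smul_comm _ _ _

lemma IsStratification.lie_mem {s : ℕ} {V : ℕ → Submodule ℝ (LieAlg N)}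
    (hV : IsStratification s V) {i j : ℕ} (hi : 1 ≤ i) (hj : 1 ≤ j) (his : i ≤ s) (hjs : j ≤ s)
    {a b : LieAlg N} (ha : a ∈ V i) (hb : b ∈ V j) :
    ⁅a, b⁆ ∈ if i + j ≤ s then V (i + j) else ⊥ := by
  have := lieGroup_minSmoothness N
  -- Extending the layers by zero beyond the step lets the induction on `i` run over all indices.
  -- The Jacobi identity passes from brackets with the first layer to brackets with layer `i + 1`.
  let W : ℕ → Submodule ℝ (LieAlg N) := fun n ↦ if n ≤ s then V n else ⊥
  have hW : ∀ n, n ≤ s → W n = V n := fun n hn ↦ if_pos hn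
  have hW0 : ∀ n, ¬ n ≤ s → W n = ⊥ := fun n hn ↦ if_neg hn
  have h1 : ∀ j, 1 ≤ j → ∀ a ∈ V 1, ∀ b ∈ W j, ⁅a, b⁆ ∈ W (1 + j) := by
    intro j hj a ha b hb
    by_cases hjs : j ≤ s
    · rw [hW j hjs] at hb
      by_cases hjs' : 1 + j ≤ s
      · rw [hW _ hjs', add_comm, ← hV.bracket_layer j hj (by omega)]
        exact Submodule.subset_span ⟨a, ha, b, hb, rfl⟩
      · obtain rfl : j = s := by omega
        rw [hV.bracket_top a ha b hb]
        exact Submodule.zero_mem _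
    · rw [hW0 j hjs, Submodule.mem_bot] at hb
      rw [hb, lie_zero]
      exact Submodule.zero_mem _
  have key : ∀ i, 1 ≤ i → ∀ j, 1 ≤ j → ∀ a ∈ W i, ∀ b ∈ W j, ⁅a, b⁆ ∈ W (i + j) := by
    intro i hi
    induction i, hi using Nat.le_induction with
    | base =>
      intro j hj a ha b hb
      rw [hW 1 hV.one_le_step] at ha
      exact h1 j hj a ha b hb
    | succ i hi ih =>
      intro j hj a ha b hb
      by_cases his : i + 1 ≤ s
      · rw [hW _ his, ← hV.bracket_layer i hi his] at ha
        induction ha using Submodule.span_induction with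
        | mem c hc =>
          obtain ⟨x, hx, y, hy, rfl⟩ := hc
          rw [← hW i (by omega)] at hy
          rw [lie_lie]
          refine Submodule.sub_mem _ ?_ ?_
          · have := h1 (i + j) (by omega) x hx _ (ih j hj y hy b hb)
            rwa [show 1 + (i + j) = i + 1 + j by ring] at this
          · have := ih (1 + j) (by omega) y hy _ (h1 j hj x hx b hb)
            rwa [show i + (1 + j) = i + 1 + j by ring] at this
        | zero => rw [zero_lie]; exact Submodule.zero_mem _
        | add x y _ _ hx hy => rw [add_lie]; exact Submodule.add_mem _ hx hy
        | smul t x _ hx => rw [smul_lie]; exact Submodule.smul_mem _ t hx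
      · rw [hW0 _ his, Submodule.mem_bot] at ha
        rw [ha, zero_lie]
        exact Submodule.zero_mem _
  exact key i hi j hj a (by rwa [hW i his]) b (by rwa [hW j hjs])

/-- The coframe: the differential at `x` of the left translation taking `x` to the identity. -/
def coframe (x : RN N) : RN N →L[ℝ] RN N := fderiv ℝ (fun y ↦ x⁻¹ * y) x

lemma coframe_leftField (v x : RN N) : coframe x (leftField v x) = v := by
  rw [coframe, ← leftField_mul, inv_mul_cancel, leftField_one]

lemma leftField_coframe (u x : RN N) : leftField (coframe x u) x = u := by
  have h : (fun y : RN N ↦ x * y) ∘ (fun y ↦ x⁻¹ * y) = id := by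
    ext1 y
    simp
  have h2 := fderiv_comp x (differentiable_mul_left x (x⁻¹ * x)) (differentiable_mul_left x⁻¹ x)
  rw [h, fderiv_id, inv_mul_cancel] at h2
  rw [leftField_eq]
  exact (congrArg (fun L : RN N →L[ℝ] RN N ↦ L u) h2).symm

lemma differentiable_coframe : Differentiable ℝ (coframe (N := N)) := by
  have h : ContDiff ℝ ∞ (coframe (N := N)) :=
    ContDiff.fderiv (𝕜 := ℝ) (n := ∞) (m := ∞) (f := fun x y : RN N ↦ x⁻¹ * y) (g := id)
      ((contDiff_mul_RN N).comp (((contDiff_inv_RN N).comp contDiff_fst).prodMk contDiff_snd))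
      contDiff_id (by simp)
  exact h.differentiable (by simp)

variable (N) in
lemma differentiable_fderiv_mul :
    Differentiable ℝ (fun x : RN N ↦ fderiv ℝ (fun y : RN N ↦ x * y) 1) := by
  have h : ContDiff ℝ ∞ (fun x : RN N ↦ fderiv ℝ (fun y : RN N ↦ x * y) 1) :=
    ContDiff.fderiv (𝕜 := ℝ) (n := ∞) (m := ∞) (f := fun x y : RN N ↦ x * y)
      (g := fun _ ↦ (1 : RN N)) (contDiff_mul_RN N) contDiff_const (by simp)
  exact h.differentiable (by simp)

/-- The product rule for a left invariant field with variable coefficients along a curve. -/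
lemma hasDerivAt_leftField {ξ η : ℝ → RN N} {ξ' η' : RN N} {t : ℝ} (hξ : HasDerivAt ξ ξ' t)
    (hη : HasDerivAt η η' t) :
    HasDerivAt (fun t ↦ leftField (ξ t) (η t))
      (fderiv ℝ (leftField (ξ t)) (η t) η' + leftField ξ' (η t)) t := by
  let A : RN N → RN N →L[ℝ] RN N := fun x ↦ fderiv ℝ (fun y : RN N ↦ x * y) 1
  have hA : ∀ x, HasFDerivAt A (fderiv ℝ A x) x :=
    fun x ↦ (differentiable_fderiv_mul N x).hasFDerivAt
  have h1 : ∀ v, leftField v = fun x ↦ A x v := fun v ↦ funext (leftField_eq v)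
  have h2 : fderiv ℝ (leftField (ξ t)) (η t) η' = (fderiv ℝ A (η t) η') (ξ t) := by
    have := (hA (η t)).clm_apply (hasFDerivAt_const (ξ t) (η t))
    rw [h1, this.fderiv]
    simp
  have h3 := ((hA (η t)).comp_hasDerivAt t hη).clm_apply hξ
  rw [h2]
  simp only [h1]
  exact h3

namespace CarnotGroup

/-- Differentiate `leftField_ray` as `x` moves in the direction `e`; both the field and the point at
which it is evaluated vary. -/
lemma fderiv_leftField_ray (𝔾 : CarnotGroup N) (x e : RN N) (t : ℝ) :
    fderiv ℝ (leftField x) (t • x) (t • e) + leftField e (t • x) = e := by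
  have h1 : HasDerivAt (fun s : ℝ ↦ x + s • e) e 0 := by
    simpa using ((hasDerivAt_id (0 : ℝ)).smul_const e).const_add x
  have h2 := hasDerivAt_leftField h1 (h1.fun_const_smul t)
  have h3 : (fun s : ℝ ↦ leftField (x + s • e) (t • (x + s • e))) = fun s ↦ x + s • e :=
    funext fun s ↦ 𝔾.leftField_ray _ _
  rw [h3] at h2
  simpa using h2.unique h1

/-- The Maurer–Cartan equation along a ray. -/
lemma hasDerivAt_coframe_ray (𝔾 : CarnotGroup N) (x e : RN N) (t : ℝ) :
    HasDerivAt (fun t : ℝ ↦ t • coframe (t • x) e)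
      (e - lieBr x (t • coframe (t • x) e)) t := by
  have hray : HasDerivAt (fun t : ℝ ↦ t • x) x t := by
    simpa using (hasDerivAt_id t).smul_const x
  have hd : DifferentiableAt ℝ (fun t : ℝ ↦ t • coframe (t • x) e) t := by
    have : DifferentiableAt ℝ (fun t : ℝ ↦ coframe (t • x)) t :=
      DifferentiableAt.comp (g := coframe) t (differentiable_coframe (t • x))
        hray.differentiableAt
    fun_prop
  -- `t • e` is the variation of the ray when `x` moves along `e`, and `ξ` is that variation read in
  -- the Lie algebra. Differentiating it in `t`, and replacing the derivatives of the fields by the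
  -- bracket formula and `fderiv_leftField_ray`, gives the equation for `ξ`.
  set ξ : ℝ → RN N := fun t : ℝ ↦ t • coframe (t • x) e with hξdef
  have hξ : ∀ t, leftField (ξ t) (t • x) = t • e := fun t ↦ by
    rw [hξdef, leftField_smul, leftField_coframe]
  have h1 := hasDerivAt_leftField hd.hasDerivAt hray
  simp only [hξ] at h1
  have h2 := h1.unique (by simpa using (hasDerivAt_id t).smul_const e)
  have h3 := leftField_lieBr x (ξ t) (t • x)
  rw [𝔾.leftField_ray, hξ] at h3
  have h4 := 𝔾.fderiv_leftField_ray x e t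
  have h5 : leftField (_root_.deriv ξ t) (t • x) =
      leftField e (t • x) - leftField (lieBr x (ξ t)) (t • x) := by
    rw [h3, eq_sub_of_add_eq' h2, eq_sub_of_add_eq' h4]
    abel
  have h6 := congrArg (coframe (t • x)) h5
  rw [map_sub, coframe_leftField, coframe_leftField, coframe_leftField] at h6
  rw [← h6]
  exact hd.hasDerivAt

variable (𝔾 : CarnotGroup N)

/-- The homogeneities as integer weights. -/
def wt (i : Fin N) : ℤ := 𝔾.d i

lemma wt_pos (i : Fin N) : 0 < 𝔾.wt i := by
  have := (𝔾.d_mem i).1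
  simp only [wt]
  omega

lemma lieBr_basis_ne_zero {i l k : Fin N}
    (h : lieBr (EuclideanSpace.single i (1 : ℝ) : RN N) (EuclideanSpace.single l 1) k ≠ 0) :
    𝔾.d k = 𝔾.d i + 𝔾.d l := by
  have hmem : ∀ i, 𝔾.X i ∈ 𝔾.V (𝔾.d i) := fun i ↦ by
    rw [𝔾.adapted _ (𝔾.d_mem i)]
    exact Submodule.subset_span ⟨i, rfl, rfl⟩
  have h1 := 𝔾.stratification.lie_mem (𝔾.d_mem i).1 (𝔾.d_mem l).1 (𝔾.d_mem i).2 (𝔾.d_mem l).2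
    (hmem i) (hmem l)
  have h2 : lieBr (EuclideanSpace.single i (1 : ℝ) : RN N) (EuclideanSpace.single l 1) =
      ⁅𝔾.X i, 𝔾.X l⁆ := by
    rw [𝔾.basis_eq, 𝔾.basis_eq]
    rfl
  replace h : 𝔾.X.repr ⁅𝔾.X i, 𝔾.X l⁆ k ≠ 0 := fun h0 ↦ h ((𝔾.repr_eq _ k).symm.trans
    ((congrArg (fun u : LieAlg N ↦ 𝔾.X.repr u k) h2).trans h0))
  split_ifs at h1 with hs
  · rw [𝔾.adapted _ ⟨by have := (𝔾.d_mem i).1; omega, hs⟩, Module.Basis.mem_span_image] at h1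
    exact h1 (Finsupp.mem_support_iff.2 h)
  · rw [Submodule.mem_bot] at h1
    rw [h1] at h
    simp at h

open MvPolynomial

/-- The `k`-th component of the Maurer–Cartan equation involves only coframe components of weight
below `d k`, because bracketing adds weights and all weights are positive. Induction on the weight
makes its right side a polynomial, and its radial primitive is the component sought. -/
lemma exists_coframe_poly (k j : Fin N) :
    ∃ b ∈ polyWt 𝔾.wt {𝔾.wt k - 𝔾.wt j}, ∀ x : RN N,
      polyFun b x = coframe x (EuclideanSpace.single j 1) k := by
  classical
  induction hn : 𝔾.d k using Nat.strong_induction_on generalizing k with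
  | _ n ih =>
  have ih' : ∀ l, ∃ b : MvPolynomial (Fin N) ℝ, 𝔾.d l < n → b ∈ polyWt 𝔾.wt {𝔾.wt l - 𝔾.wt j} ∧
      ∀ x : RN N, polyFun b x = coframe x (EuclideanSpace.single j 1) l := by
    intro l
    by_cases hl : 𝔾.d l < n
    · obtain ⟨b, hb⟩ := ih _ hl l rfl
      exact ⟨b, fun _ ↦ hb⟩
    · exact ⟨0, fun h ↦ absurd h hl⟩
  choose b hb using ih'
  let c : Fin N → Fin N → ℝ := fun i l ↦
    lieBr (EuclideanSpace.single i (1 : ℝ) : RN N) (EuclideanSpace.single l 1) k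
  have hc : ∀ i l, c i l ≠ 0 → 𝔾.d l < n ∧ 𝔾.wt k = 𝔾.wt i + 𝔾.wt l := by
    intro i l h
    have h1 := 𝔾.lieBr_basis_ne_zero h
    have h2 := (𝔾.d_mem i).1
    simp only [wt]
    omega
  -- The factor `t` in `t • coframe (t • x) e` joins `x i` to form the `i`-th coordinate of `t • x`,
  -- so the right side is `h` evaluated on the ray.
  let h : MvPolynomial (Fin N) ℝ := C ((EuclideanSpace.single j (1 : ℝ) : RN N) k) -
    ∑ i, ∑ l, C (c i l) * (MvPolynomial.X i * b l)
  refine ⟨radialPrim h, radialPrim_mem_polyWt (Submodule.sub_mem _ ?_ (Submodule.sum_mem _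
    fun i _ ↦ Submodule.sum_mem _ fun l _ ↦ ?_)), fun x ↦ ?_⟩
  · by_cases hkj : k = j
    · exact C_mem_polyWt _ (by simp [hkj])
    · simp [hkj]
  · by_cases h0 : c i l = 0
    · simp [h0]
    obtain ⟨h1, h2⟩ := hc i l h0
    refine mul_mem_polyWt (C_mem_polyWt (s := {0}) _ rfl)
      (mul_mem_polyWt (t := {𝔾.wt l - 𝔾.wt j}) (u := {𝔾.wt k - 𝔾.wt j})
        (X_mem_polyWt (s := {𝔾.wt i}) i rfl) (hb l h1).1 ?_) ?_
    · rintro _ rfl _ rfl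
      simp only [mem_singleton_iff]
      omega
    · rintro _ rfl _ rfl
      simp
  · have hφ : ∀ t, HasDerivAt (fun t : ℝ ↦ (t • coframe (t • x) (EuclideanSpace.single j 1)) k)
        (polyFun h (t • x)) t := by
      intro t
      have h1 := 𝔾.hasDerivAt_coframe_ray x (EuclideanSpace.single j 1) t
      have h2 := (EuclideanSpace.proj k : RN N →L[ℝ] ℝ).hasFDerivAt.comp_hasDerivAt t h1
      convert! h2 using 1
      rw [lieBr_eq_sum]
      simp only [h, polyFun_sub, polyFun_C, polyFun_sum, polyFun_mul, polyFun_X, map_sub, map_sum,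
        map_smul, PiLp.proj_apply, PiLp.smul_apply, smul_eq_mul]
      congr 1
      refine Finset.sum_congr rfl fun i _ ↦ Finset.sum_congr rfl fun l _ ↦ ?_
      change c i l * _ = _ * c i l
      by_cases h0 : c i l = 0
      · simp [h0]
      rw [(hb l (hc i l h0).1).2]
      ring
    have := eq_radialPrim hφ
    simpa using this.symm

/-- A polynomial of nonpositive weight is constant, and at the identity the coframe is the identity
map. -/
lemma coframe_apply_of_le {k j : Fin N} (h : 𝔾.d k ≤ 𝔾.d j) (x : RN N) :
    coframe x (EuclideanSpace.single j 1) k = (EuclideanSpace.single j (1 : ℝ) : RN N) k := by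
  obtain ⟨b, hb, hbx⟩ := 𝔾.exists_coframe_poly k j
  have h1 := polyWt_eq_const 𝔾.wt_pos (fun a ha ↦ by
    rw [mem_singleton_iff.1 ha]
    simp only [wt]
    omega) hb
  have h2 : polyFun b x = polyFun b 0 := by
    rw [h1, polyFun_C, polyFun_C]
  rw [← hbx, h2, hbx, ← 𝔾.one_eq_zero]
  have h3 := coframe_leftField (EuclideanSpace.single j (1 : ℝ)) (1 : RN N)
  rw [leftField_one] at h3
  rw [h3]

lemma sum_coframe_mul_field (x : RN N) (k j : Fin N) :
    ∑ l, coframe x (EuclideanSpace.single l 1) k * 𝔾.field j x l =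
      (EuclideanSpace.single j (1 : ℝ) : RN N) k := by
  have h1 := coframe_leftField (EuclideanSpace.single j (1 : ℝ)) x
  rw [← 𝔾.field_eq] at h1
  have h2 : 𝔾.field j x = ∑ l, 𝔾.field j x l • (EuclideanSpace.single l (1 : ℝ) : RN N) := by
    ext i
    simp [Pi.single_apply]
  rw [h2, map_sum] at h1
  conv_rhs => rw [← h1]
  simp [mul_comm]

/-- In exponential coordinates the components of the left invariant fields are homogeneous
polynomials. -/
lemma exists_field_poly (k j : Fin N) :
    ∃ a ∈ polyWt 𝔾.wt {𝔾.wt k - 𝔾.wt j}, ∀ x : RN N, polyFun a x = 𝔾.field j x k := by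
  classical
  induction hn : 𝔾.d k using Nat.strong_induction_on generalizing k with
  | _ n ih =>
  have ih' : ∀ l, ∃ b : MvPolynomial (Fin N) ℝ, 𝔾.d l < n → b ∈ polyWt 𝔾.wt {𝔾.wt l - 𝔾.wt j} ∧
      ∀ x : RN N, polyFun b x = 𝔾.field j x l := by
    intro l
    by_cases hl : 𝔾.d l < n
    · obtain ⟨b, hb⟩ := ih _ hl l rfl
      exact ⟨b, fun _ ↦ hb⟩
    · exact ⟨0, fun h ↦ absurd h hl⟩
  choose a ha using ih'
  choose b hb hbx using fun l ↦ 𝔾.exists_coframe_poly k l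
  -- The fields invert the coframe. In row `k` the only term of weight at least `d k` is the
  -- diagonal one, with coefficient one, so the equation can be solved for the `k`-th component.
  refine ⟨C ((EuclideanSpace.single j (1 : ℝ) : RN N) k) -
    ∑ l with 𝔾.d l < n, b l * a l, Submodule.sub_mem _ ?_ (Submodule.sum_mem _
    fun l hl ↦ ?_), fun x ↦ ?_⟩
  · by_cases hkj : k = j
    · exact C_mem_polyWt _ (by simp [hkj])
    · simp [hkj]
  · rw [Finset.mem_filter] at hl
    refine mul_mem_polyWt (hb l) (ha l hl.2).1 ?_
    rintro _ rfl _ rfl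
    simp
  · have h1 := 𝔾.sum_coframe_mul_field x k j
    rw [← Finset.sum_filter_add_sum_filter_not _ (fun l ↦ 𝔾.d l < n)] at h1
    have h2 : ∑ l with ¬ 𝔾.d l < n, coframe x (EuclideanSpace.single l 1) k * 𝔾.field j x l =
        𝔾.field j x k := by
      rw [Finset.sum_eq_single k]
      · rw [𝔾.coframe_apply_of_le le_rfl]
        simp
      · intro l hl hlk
        rw [Finset.mem_filter] at hl
        rw [𝔾.coframe_apply_of_le (by omega)]
        simp [Ne.symm hlk]
      · intro hk
        exact absurd (Finset.mem_filter.2 ⟨Finset.mem_univ _, by omega⟩) hk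
    rw [h2] at h1
    rw [polyFun_sub, polyFun_C, polyFun_sum, ← h1, sub_eq_iff_eq_add']
    congr 1
    refine Finset.sum_congr rfl fun l hl ↦ ?_
    rw [Finset.mem_filter] at hl
    rw [polyFun_mul, hbx, (ha l hl.2).2]

lemma field_apply_of_le {k j : Fin N} (h : 𝔾.d k ≤ 𝔾.d j) (x : RN N) :
    𝔾.field j x k = (EuclideanSpace.single j (1 : ℝ) : RN N) k := by
  obtain ⟨b, hb, hbx⟩ := 𝔾.exists_field_poly k j
  have h1 := polyWt_eq_const 𝔾.wt_pos (fun a ha ↦ by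
    rw [mem_singleton_iff.1 ha]
    simp only [wt]
    omega) hb
  have h2 : polyFun b x = polyFun b 0 := by
    rw [h1, polyFun_C, polyFun_C]
  rw [← hbx, h2, hbx, ← 𝔾.one_eq_zero, 𝔾.field_eq, leftField_one]

/-- The columns of the matrix are the fields. Since the basis is listed by increasing weight, the
matrix is lower triangular with ones on the diagonal. -/
lemma det_fderiv_mul_one (𝔾 : CarnotGroup N) (x : RN N) : (fderiv ℝ (fun y : RN N ↦ x * y) 1).det = 1 := by
  classical
  let e := (EuclideanSpace.basisFun (Fin N) ℝ).toBasis
  change LinearMap.det (fderiv ℝ (fun y : RN N ↦ x * y) 1 : RN N →ₗ[ℝ] RN N) = 1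
  have hM : ∀ k j, LinearMap.toMatrix e e
      (fderiv ℝ (fun y : RN N ↦ x * y) 1 : RN N →ₗ[ℝ] RN N) k j = 𝔾.field j x k := by
    intro k j
    rw [LinearMap.toMatrix_apply, 𝔾.field_eq, leftField_eq]
    simp [e]
  rw [← LinearMap.det_toMatrix e, Matrix.det_of_isLowerTriangular]
  · refine Finset.prod_eq_one fun i _ ↦ ?_
    rw [hM, 𝔾.field_apply_of_le le_rfl]
    simp
  · intro i j hij
    have hij' : i < j := hij
    rw [hM, 𝔾.field_apply_of_le (𝔾.d_mono hij'.le)]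
    simp [hij'.ne]

/-- Left translations preserve the volume. -/
lemma det_fderiv_mul (𝔾 : CarnotGroup N) (g y : RN N) : (fderiv ℝ (fun y : RN N ↦ g * y) y).det = 1 := by
  have h : (fun z : RN N ↦ g * y * z) = (fun z ↦ g * z) ∘ (fun z ↦ y * z) := by
    ext1 z
    simp [mul_assoc]
  have h1 := 𝔾.det_fderiv_mul_one (g * y)
  rw [h, fderiv_comp _ (differentiable_mul_left g _) (differentiable_mul_left y _), mul_one] at h1
  have h2 : ((fderiv ℝ (fun y : RN N ↦ g * y) y).comp (fderiv ℝ (fun z : RN N ↦ y * z) 1)).det =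
    (fderiv ℝ (fun y : RN N ↦ g * y) y).det * (fderiv ℝ (fun z : RN N ↦ y * z) 1).det :=
    LinearMap.det_comp _ _
  rwa [h2, 𝔾.det_fderiv_mul_one, mul_one] at h1

end CarnotGroup

end Frame

/-! ### Left invariant operators and left translations acting on polynomials -/

namespace CarnotGroup

open MvPolynomial

variable {N : ℕ} [Group (RN N)] [LieGroup 𝓘(ℝ, RN N) ∞ (RN N)] (𝔾 : CarnotGroup N)

/-- The `k`-th component of `X_j` as a polynomial. -/
def fieldPoly (k j : Fin N) : MvPolynomial (Fin N) ℝ := (𝔾.exists_field_poly k j).choose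

lemma fieldPoly_mem (k j : Fin N) : 𝔾.fieldPoly k j ∈ polyWt 𝔾.wt {𝔾.wt k - 𝔾.wt j} :=
  (𝔾.exists_field_poly k j).choose_spec.1

lemma polyFun_fieldPoly (k j : Fin N) (x : RN N) : polyFun (𝔾.fieldPoly k j) x = 𝔾.field j x k :=
  (𝔾.exists_field_poly k j).choose_spec.2 x

/-- The action of `X_j` on polynomials. -/
def fieldOp (j : Fin N) : Module.End ℝ (MvPolynomial (Fin N) ℝ) :=
  ∑ i, (LinearMap.mulLeft ℝ (𝔾.fieldPoly i j)).comp (pderiv i).toLinearMap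

lemma fieldOp_apply (j : Fin N) (P : MvPolynomial (Fin N) ℝ) :
    𝔾.fieldOp j P = ∑ i, 𝔾.fieldPoly i j * pderiv i P := by
  simp [fieldOp]

/-- The derivative in `x_i` lowers the weight by `d i`, and the coefficient in front of it restores
`d i - d j`. -/
lemma fieldOp_mem {j : Fin N} {s t : Set ℤ} {P : MvPolynomial (Fin N) ℝ}
    (hP : P ∈ polyWt 𝔾.wt s) (h : ∀ a ∈ s, a - 𝔾.wt j ∈ t) :
    𝔾.fieldOp j P ∈ polyWt 𝔾.wt t := by
  rw [fieldOp_apply]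
  refine Submodule.sum_mem _ fun i _ ↦ mul_mem_polyWt (𝔾.fieldPoly_mem i j)
    (pderiv_mem_polyWt (t := {b | b + 𝔾.wt i ∈ s}) hP fun a ha ↦ by simpa using ha) ?_
  rintro _ rfl b hb
  have := h _ hb
  rwa [show b + 𝔾.wt i - 𝔾.wt j = 𝔾.wt i - 𝔾.wt j + b by ring] at this

lemma polyFun_fieldOp (j : Fin N) (P : MvPolynomial (Fin N) ℝ) :
    polyFun (𝔾.fieldOp j P) = 𝔾.deriv j (polyFun P) := by
  ext x
  rw [CarnotGroup.deriv, fderiv_polyFun, fieldOp_apply, polyFun_sum]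
  simp only [polyFun_mul, polyFun_fieldPoly]

/-- The vector fields are left invariant. -/
lemma deriv_comp_mul_left (j : Fin N) {f : RN N → ℝ} (hf : Differentiable ℝ f) (g x : RN N) :
    𝔾.deriv j (fun y ↦ f (g * y)) x = 𝔾.deriv j f (g * x) := by
  have h : fderiv ℝ (fun y ↦ f (g * y)) x =
      (fderiv ℝ f (g * x)).comp (fderiv ℝ (fun y ↦ g * y) x) :=
    fderiv_comp (g := f) x (hf _) (differentiable_mul_left g x)
  rw [CarnotGroup.deriv, h, CarnotGroup.deriv, field_eq, field_eq, leftField_mul]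
  rfl

lemma polyFun_fieldOp_translate (j : Fin N) {g : RN N} {P P' : MvPolynomial (Fin N) ℝ}
    (h : ∀ y, polyFun P' y = polyFun P (g * y)) (y : RN N) :
    polyFun (𝔾.fieldOp j P') y = polyFun (𝔾.fieldOp j P) (g * y) := by
  rw [polyFun_fieldOp, polyFun_fieldOp, ← 𝔾.deriv_comp_mul_left j (differentiable_polyFun P),
    ← funext h]

/-- Left translations preserve the polynomials of weight at most `m`. -/
lemma exists_translate (g : RN N) {m : ℤ} {P : MvPolynomial (Fin N) ℝ}
    (hP : P ∈ polyWt 𝔾.wt {a | a ≤ m}) :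
    ∃ P' ∈ polyWt 𝔾.wt {a | a ≤ m}, ∀ y, polyFun P' y = polyFun P (g * y) := by
  obtain ⟨n, hn⟩ : ∃ n : ℕ, m < n := ⟨m.toNat + 1, by omega⟩
  induction n generalizing m P with
  | zero =>
    refine ⟨0, Submodule.zero_mem _, fun y ↦ ?_⟩
    rw [polyWt_eq_zero 𝔾.wt_pos (fun a ha ↦ lt_of_le_of_lt ha (by simpa using hn)) hP]
    simp
  | succ n ih =>
    by_cases hm : m < 0
    · refine ⟨0, Submodule.zero_mem _, fun y ↦ ?_⟩
      rw [polyWt_eq_zero 𝔾.wt_pos (fun a ha ↦ lt_of_le_of_lt ha hm) hP]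
      simp
    -- The derivatives `X_i P` have smaller weight, so their translates are already polynomials. As
    -- `y = ∑ y_i X_i` at each point of the ray through `y`, the translate of `P` is `P(g)` plus an
    -- integral of these along the ray.
    have hq : ∀ i, ∃ q ∈ polyWt 𝔾.wt {a | a ≤ m - 𝔾.wt i},
        ∀ y, polyFun q y = polyFun (𝔾.fieldOp i P) (g * y) := fun i ↦ by
      refine ih (𝔾.fieldOp_mem hP fun a ha ↦ ?_) ?_
      · simpa using ha
      · have := 𝔾.wt_pos i
        push_cast at hn
        omega
    choose q hq hqy using hq
    refine ⟨C (polyFun P g) + ∑ i, MvPolynomial.X i * radialPrim (q i), Submodule.add_mem _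
      (C_mem_polyWt _ (by simpa using hm)) (Submodule.sum_mem _ fun i _ ↦
        mul_mem_polyWt (X_mem_polyWt (s := {𝔾.wt i}) i rfl) (radialPrim_mem_polyWt (hq i)) ?_),
      fun y ↦ ?_⟩
    · rintro _ rfl b hb
      simp only [mem_ofPred_eq] at hb ⊢
      omega
    let φ : ℝ → ℝ := fun t ↦ polyFun P (g * t • y)
    have hφ : ∀ t, HasDerivAt φ (∑ i, y i * polyFun (q i) (t • y)) t := by
      intro t
      have hray : HasDerivAt (fun t : ℝ ↦ t • y) y t := by
        simpa using (hasDerivAt_id t).smul_const y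
      have hf : Differentiable ℝ (fun y ↦ polyFun P (g * y)) :=
        (differentiable_polyFun P).comp (differentiable_mul_left g)
      have h1 := (hf (t • y)).hasFDerivAt.comp_hasDerivAt t hray
      have h2 : y = ∑ i, y i • 𝔾.field i (t • y) := by
        rw [← 𝔾.leftField_eq_sum, 𝔾.leftField_ray]
      have h3 : fderiv ℝ (fun y ↦ polyFun P (g * y)) (t • y) y =
          ∑ i, y i * polyFun (q i) (t • y) := by
        conv_lhs => enter [2]; rw [h2]
        rw [map_sum]
        refine Finset.sum_congr rfl fun i _ ↦ ?_
        rw [map_smul, smul_eq_mul, hqy, polyFun_fieldOp,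
          ← 𝔾.deriv_comp_mul_left i (differentiable_polyFun P)]
        rfl
      rw [← h3]
      exact h1
    have hψ : ∀ t, HasDerivAt (fun t ↦ φ t - ∑ i, y i * (t * polyFun (radialPrim (q i)) (t • y)))
        0 t := fun t ↦ by
      have := (hφ t).fun_sub (HasDerivAt.fun_sum (u := Finset.univ) fun i _ ↦
        (hasDerivAt_radialPrim (q i) y t).const_mul (y i))
      simpa using this
    have h := is_const_of_deriv_eq_zero (fun t ↦ (hψ t).differentiableAt)
      (fun t ↦ (hψ t).deriv) 1 0
    simp only [φ, one_smul, zero_smul, one_mul, zero_mul, mul_zero, Finset.sum_const_zero,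
      sub_zero, ← 𝔾.one_eq_zero, mul_one] at h
    simp only [polyFun_add, polyFun_C, polyFun_sum, polyFun_mul, polyFun_X]
    linarith

/-- The action of `X^α` on polynomials. -/
def iterOp (α : Fin N → ℕ) : Module.End ℝ (MvPolynomial (Fin N) ℝ) :=
  ((List.finRange N).map fun i ↦ 𝔾.fieldOp i ^ α i).prod

lemma polyFun_fieldOp_pow (i : Fin N) (n : ℕ) (P : MvPolynomial (Fin N) ℝ) :
    polyFun ((𝔾.fieldOp i ^ n) P) = (𝔾.deriv i)^[n] (polyFun P) := by
  induction n with
  | zero => rfl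
  | succ n ih => rw [pow_succ', Module.End.mul_apply, polyFun_fieldOp, ih,
      Function.iterate_succ_apply']

lemma polyFun_iterOp (α : Fin N → ℕ) (P : MvPolynomial (Fin N) ℝ) :
    polyFun (𝔾.iterOp α P) = 𝔾.iterDeriv α (polyFun P) := by
  rw [iterOp, iterDeriv]
  induction List.finRange N with
  | nil => rfl
  | cons i l ih => rw [List.map_cons, List.prod_cons, Module.End.mul_apply, polyFun_fieldOp_pow,
      ih, List.foldr_cons]

lemma polyFun_iterOp_translate (α : Fin N → ℕ) {g : RN N} {P P' : MvPolynomial (Fin N) ℝ}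
    (h : ∀ y, polyFun P' y = polyFun P (g * y)) (y : RN N) :
    polyFun (𝔾.iterOp α P') y = polyFun (𝔾.iterOp α P) (g * y) := by
  rw [iterOp]
  induction List.finRange N generalizing y with
  | nil => exact h y
  | cons i l ih =>
    simp only [List.map_cons, List.prod_cons, Module.End.mul_apply]
    induction α i generalizing y with
    | zero => exact ih y
    | succ n ih' =>
      simp only [pow_succ', Module.End.mul_apply]
      exact 𝔾.polyFun_fieldOp_translate i ih' y

lemma iterOp_mem {α : Fin N → ℕ} {m : ℤ} {P : MvPolynomial (Fin N) ℝ}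
    (hP : P ∈ polyWt 𝔾.wt {m}) : 𝔾.iterOp α P ∈ polyWt 𝔾.wt {m - 𝔾.homNorm α} := by
  have h : (𝔾.homNorm α : ℤ) = ((List.finRange N).map fun i ↦ 𝔾.wt i * (α i : ℤ)).sum := by
    rw [← Fin.sum_univ_def, homNorm]
    push_cast
    rfl
  rw [h, iterOp]
  induction List.finRange N with
  | nil => simpa using hP
  | cons i l ih =>
    simp only [List.map_cons, List.prod_cons, Module.End.mul_apply, List.sum_cons]
    induction α i with
    | zero => simpa using ih
    | succ n ih' =>
      rw [pow_succ', Module.End.mul_apply]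
      refine 𝔾.fieldOp_mem ih' ?_
      rintro _ rfl
      simp only [mem_singleton_iff]
      push_cast
      ring

lemma homNorm_cast (J : Fin N →₀ ℕ) : (𝔾.homNorm (fun i ↦ J i) : ℤ) = ∑ i, 𝔾.wt i * (J i : ℤ) := by
  rw [homNorm]
  push_cast
  rfl

lemma homDegreeLE_iff {P : MvPolynomial (Fin N) ℝ} {k : ℕ} :
    𝔾.HomDegreeLE P k ↔ P ∈ polyWt 𝔾.wt {a | a ≤ (k : ℤ)} := by
  rw [mem_polyWt]
  refine forall_congr' fun J ↦ ?_
  rw [mem_support_iff, mem_ofPred_eq, ← homNorm_cast, Nat.cast_le]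

lemma finite_homNorm_le (k : ℕ) : {α : Fin N → ℕ | 𝔾.homNorm α ≤ k}.Finite := by
  refine (Set.finite_Iic fun _ : Fin N ↦ k).subset fun α hα i ↦ ?_
  calc α i ≤ 𝔾.d i * α i := Nat.le_mul_of_pos_left _ (𝔾.d_mem i).1
    _ ≤ 𝔾.homNorm α := Finset.single_le_sum (f := fun i ↦ 𝔾.d i * α i) (fun _ _ ↦ Nat.zero_le _)
        (Finset.mem_univ i)
    _ ≤ k := hα

lemma finite_homNorm_le_finsupp (k : ℕ) :
    {J : Fin N →₀ ℕ | 𝔾.homNorm (fun i ↦ J i) ≤ k}.Finite :=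
  (𝔾.finite_homNorm_le k).preimage DFunLike.coe_injective.injOn

/-- The derivative `X^α P` at the identity only involves the coefficients of weight `|α|`. -/
lemma exists_iterDeriv_le (k : ℕ) (S : Finset (Fin N →₀ ℕ)) :
    ∃ M : ℝ, 0 ≤ M ∧ ∀ P : MvPolynomial (Fin N) ℝ, 𝔾.HomDegreeLE P k → P.support ⊆ S →
      ∀ α : Fin N → ℕ, ∀ B : ℝ, 0 ≤ B →
      (∀ J, 𝔾.homNorm (fun i ↦ J i) = 𝔾.homNorm α → |coeff J P| ≤ B) →
      |polyFun (𝔾.iterOp α P) 1| ≤ M * B := by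
  let T := (𝔾.finite_homNorm_le k).toFinset
  let F : (Fin N → ℕ) → (Fin N →₀ ℕ) → ℝ := fun α J ↦ |polyFun (𝔾.iterOp α (monomial J 1)) 1|
  have hF : ∀ α J, 0 ≤ F α J := fun α J ↦ abs_nonneg _
  -- Summing over the finite set `T` makes the constant independent of `α`; for `α` outside `T` no
  -- monomial of `P` has matching weight and the derivative vanishes.
  refine ⟨∑ α ∈ T, ∑ J ∈ S, F α J,
    Finset.sum_nonneg fun α _ ↦ Finset.sum_nonneg fun J _ ↦ hF α J, fun P hPk hPS α B hB h ↦ ?_⟩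
  have h1 : polyFun (𝔾.iterOp α P) 1 =
      ∑ J ∈ P.support, coeff J P * polyFun (𝔾.iterOp α (monomial J 1)) 1 := by
    conv_lhs => rw [P.as_sum, map_sum, polyFun_sum]
    refine Finset.sum_congr rfl fun J _ ↦ ?_
    have : monomial J (coeff J P) = coeff J P • monomial J (1 : ℝ) := by
      rw [smul_monomial, smul_eq_mul, mul_one]
    rw [this, map_smul, smul_eq_C_mul, polyFun_mul, polyFun_C]
  -- `X^α` of the monomial has the single weight `|J| - |α|`; when this is nonzero there is no
  -- constant term, hence no value at the origin.
  have h2 : ∀ J, 𝔾.homNorm (fun i ↦ J i) ≠ 𝔾.homNorm α →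
      polyFun (𝔾.iterOp α (monomial J 1)) 1 = 0 := by
    intro J hJ
    have h3 := 𝔾.iterOp_mem (α := α) (monomial_mem_polyWt (w := 𝔾.wt) (J := J) (1 : ℝ)
      (mem_singleton _))
    rw [𝔾.one_eq_zero, polyFun_at_zero]
    by_contra hne
    have h4 := mem_polyWt.1 h3 0 hne
    have h5 : ∑ i, 𝔾.wt i * ((0 : Fin N →₀ ℕ) i : ℤ) = 0 := by simp
    have h6 := 𝔾.homNorm_cast J
    rw [mem_singleton_iff, h5] at h4
    omega
  rw [h1]
  by_cases hα : α ∈ T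
  · calc |∑ J ∈ P.support, coeff J P * polyFun (𝔾.iterOp α (monomial J 1)) 1|
        ≤ ∑ J ∈ P.support, F α J * B := by
          refine (Finset.abs_sum_le_sum_abs _ _).trans (Finset.sum_le_sum fun J _ ↦ ?_)
          rw [abs_mul, mul_comm]
          by_cases hJ : 𝔾.homNorm (fun i ↦ J i) = 𝔾.homNorm α
          · exact mul_le_mul_of_nonneg_left (h J hJ) (hF α J)
          · rw [h2 J hJ, abs_zero, zero_mul]
            exact mul_nonneg (hF α J) hB
      _ ≤ ∑ J ∈ S, F α J * B :=
          Finset.sum_le_sum_of_subset_of_nonneg hPS fun J _ _ ↦ mul_nonneg (hF α J) hB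
      _ = (∑ J ∈ S, F α J) * B := by rw [Finset.sum_mul]
      _ ≤ _ := by
          gcongr
          exact Finset.single_le_sum (f := fun α ↦ ∑ J ∈ S, F α J)
            (fun α _ ↦ Finset.sum_nonneg fun J _ ↦ hF α J) hα
  · rw [Finset.sum_eq_zero fun J hJ ↦ ?_, abs_zero]
    · exact mul_nonneg (Finset.sum_nonneg fun α _ ↦ Finset.sum_nonneg fun J _ ↦ hF α J) hB
    · rw [h2 J fun hh ↦ hα ?_, mul_zero]
      have := hPk J hJ
      rw [hh] at this
      simpa [T] using this

end CarnotGroup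

/-! ### Horizontal curves and the size of Carnot–Carathéodory balls -/

section AbsolutelyContinuous

lemma AbsolutelyContinuousOnInterval.congr' {f g : ℝ → ℝ} {a b : ℝ}
    (hf : AbsolutelyContinuousOnInterval f a b) (h : EqOn f g (uIcc a b)) :
    AbsolutelyContinuousOnInterval g a b := by
  rw [absolutelyContinuousOnInterval_iff] at hf ⊢
  intro ε hε
  obtain ⟨δ, hδ, hE⟩ := hf ε hε
  refine ⟨δ, hδ, fun E hEm hs ↦ ?_⟩
  have := hE E hEm hs
  rwa [Finset.sum_congr rfl fun i hi ↦ by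
    rw [← h (hEm.1 i hi).1, ← h (hEm.1 i hi).2]]

lemma absolutelyContinuousOnInterval_const (c a b : ℝ) :
    AbsolutelyContinuousOnInterval (fun _ ↦ c) a b :=
  (LipschitzWith.const c).lipschitzOnWith.absolutelyContinuousOnInterval (K := 0)

lemma absolutelyContinuousOnInterval_polyFun {N : ℕ} {γ : ℝ → RN N} {a b : ℝ}
    (hγ : ∀ i, AbsolutelyContinuousOnInterval (fun t ↦ γ t i) a b)
    (p : MvPolynomial (Fin N) ℝ) :
    AbsolutelyContinuousOnInterval (fun t ↦ polyFun p (γ t)) a b := by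
  induction p using MvPolynomial.induction_on with
  | C c => simpa using absolutelyContinuousOnInterval_const c a b
  | add p q hp hq =>
    simp only [polyFun_add]
    exact hp.add hq
  | mul_X p i hp =>
    simp only [polyFun_mul, polyFun_X]
    exact hp.mul (hγ i)

end AbsolutelyContinuous

namespace CarnotGroup

open MvPolynomial

variable {N : ℕ} [Group (RN N)] [LieGroup 𝓘(ℝ, RN N) ∞ (RN N)] {𝔾 : CarnotGroup N}

lemma IsHorizontal.absolutelyContinuous_apply {γ : ℝ → RN N}
    {u : ℝ → EuclideanSpace ℝ {j : Fin N // 𝔾.d j = 1}} (h : 𝔾.IsHorizontal γ u) (i : Fin N) :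
    AbsolutelyContinuousOnInterval (fun t ↦ γ t i) 0 1 := by
  have hint : IntervalIntegrable (_root_.deriv γ) volume 0 1 :=
    (intervalIntegrable_iff_integrableOn_Icc_of_le zero_le_one).2 h.integrable_deriv
  let π : RN N →L[ℝ] ℝ := EuclideanSpace.proj i
  have hi : IntervalIntegrable (fun t ↦ _root_.deriv γ t i) volume 0 1 :=
    ⟨π.integrable_comp hint.1, π.integrable_comp hint.2⟩
  have h1 := (absolutelyContinuousOnInterval_const (γ 0 i) 0 1).add
    (hi.absolutelyContinuousOnInterval_intervalIntegral (c := 0) (by simp))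
  refine h1.congr' fun t ht ↦ ?_
  rw [uIcc_of_le zero_le_one] at ht
  have h2 := congrArg π (h.integral_deriv 0 (by simp) t ht)
  rw [← π.intervalIntegral_comp_comm (hint.mono_set (by
    rw [uIcc_of_le ht.1, uIcc_of_le zero_le_one]; exact Icc_subset_Icc_right ht.2))] at h2
  simp only [π, map_sub, PiLp.proj_apply] at h2
  simp only [Pi.add_apply]
  linarith

lemma hasDerivAt_translate_apply {γ : ℝ → RN N}
    {u : EuclideanSpace ℝ {j : Fin N // 𝔾.d j = 1}} {t : ℝ} (hd : DifferentiableAt ℝ γ t)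
    (h : _root_.deriv γ t = ∑ j, u j • 𝔾.field j.1 (γ t)) (g : RN N) (k : Fin N) :
    HasDerivAt (fun t ↦ (g * γ t) k) (∑ j, u j * 𝔾.field j.1 (g * γ t) k) t := by
  have h1 := (differentiable_mul_left g (γ t)).hasFDerivAt.comp_hasDerivAt t hd.hasDerivAt
  have h2 := (EuclideanSpace.proj k : RN N →L[ℝ] ℝ).hasFDerivAt.comp_hasDerivAt t h1
  convert! h2 using 1
  rw [h, map_sum, map_sum]
  refine Finset.sum_congr rfl fun j _ ↦ ?_
  rw [map_smul, map_smul, 𝔾.field_eq, 𝔾.field_eq, leftField_mul]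
  rfl

/-- The growth of a horizontal curve, translated to start at the identity, in one component. -/
lemma IsHorizontal.abs_translate_apply_le {γ : ℝ → RN N}
    {u : ℝ → EuclideanSpace ℝ {j : Fin N // 𝔾.d j = 1}} (h : 𝔾.IsHorizontal γ u) (k : Fin N)
    {B : ℝ} (hB0 : 0 ≤ B) (hB : ∀ t ∈ Icc (0 : ℝ) 1, ∀ j : {j : Fin N // 𝔾.d j = 1},
      |𝔾.field j.1 ((γ 0)⁻¹ * γ t) k| ≤ B)
    {t : ℝ} (ht : t ∈ Icc (0 : ℝ) 1) :
    |((γ 0)⁻¹ * γ t) k| ≤ (∫ t in (0 : ℝ)..1, ‖u t‖) * (N * B) := by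
  classical
  let z : ℝ → ℝ := fun t ↦ ((γ 0)⁻¹ * γ t) k
  obtain ⟨m, hm⟩ : ∃ m : ℤ, 𝔾.wt k ≤ m := ⟨_, le_rfl⟩
  -- A coordinate of the translated curve is a polynomial in the original one, so it inherits
  -- absolute continuity and is the integral of its derivative.
  obtain ⟨q, -, hq⟩ := 𝔾.exists_translate (γ 0)⁻¹ (X_mem_polyWt (w := 𝔾.wt) (s := {a | a ≤ m}) k hm)
  have hz : z = fun t ↦ polyFun q (γ t) := by
    ext t
    rw [hq, polyFun_X]
  have hsub : uIcc 0 t ⊆ uIcc (0 : ℝ) 1 := by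
    rw [uIcc_of_le ht.1, uIcc_of_le zero_le_one]
    exact Icc_subset_Icc_right ht.2
  have hac : AbsolutelyContinuousOnInterval z 0 t := by
    rw [hz]
    exact (absolutelyContinuousOnInterval_polyFun h.absolutelyContinuous_apply q).mono hsub
  have hz0 : z 0 = 0 := by
    simp only [z, inv_mul_cancel, 𝔾.one_eq_zero]
    rfl
  have hu : IntervalIntegrable (fun t ↦ ‖u t‖ * (N * B)) volume 0 1 :=
    ((intervalIntegrable_iff_integrableOn_Icc_of_le zero_le_one).2
      h.integrable_control.norm).mul_const _
  have hbound : ∀ᵐ s, s ∈ Ioc 0 t → ‖_root_.deriv z s‖ ≤ ‖u s‖ * (N * B) := by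
    have h1 := (ae_restrict_iff' measurableSet_Icc).1 h.differentiable_ae
    have h2 := (ae_restrict_iff' measurableSet_Icc).1 h.deriv_eq
    filter_upwards [h1, h2] with s hs1 hs2 hs
    have hs' : s ∈ Icc (0 : ℝ) 1 := ⟨hs.1.le, hs.2.trans ht.2⟩
    have h3 := hasDerivAt_translate_apply (hs1 hs') (hs2 hs') (γ 0)⁻¹ k
    rw [h3.deriv]
    calc ‖∑ j, u s j * 𝔾.field j.1 ((γ 0)⁻¹ * γ s) k‖
        ≤ ∑ j : {j : Fin N // 𝔾.d j = 1}, ‖u s‖ * B := by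
          refine norm_sum_le_of_le _ fun j _ ↦ ?_
          rw [norm_mul]
          exact mul_le_mul (PiLp.norm_apply_le _ _) (hB s hs' j) (abs_nonneg _) (norm_nonneg _)
      _ = ‖u s‖ * (Fintype.card {j : Fin N // 𝔾.d j = 1} * B) := by
          rw [Finset.sum_const, nsmul_eq_mul, Finset.card_univ]
          ring
      _ ≤ ‖u s‖ * (N * B) := by
          gcongr
          exact (Fintype.card_subtype_le _).trans (Fintype.card_fin N).le
  calc |z t| = ‖∫ s in (0 : ℝ)..t, _root_.deriv z s‖ := by
        rw [hac.integral_deriv_eq_sub, hz0, sub_zero, Real.norm_eq_abs]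
    _ ≤ ∫ s in (0 : ℝ)..t, ‖u s‖ * (N * B) :=
        intervalIntegral.norm_integral_le_of_norm_le ht.1 hbound (hu.mono_set hsub)
    _ ≤ ∫ s in (0 : ℝ)..1, ‖u s‖ * (N * B) :=
        intervalIntegral.integral_mono_interval le_rfl ht.1 ht.2
          (Filter.Eventually.of_forall fun s ↦ by positivity) hu
    _ = _ := by rw [intervalIntegral.integral_mul_const]

variable (𝔾)

/-- Carnot–Carathéodory balls lie in translates of anisotropic boxes. -/
lemma exists_ball_subset_box :
    ∃ K : ℝ, 0 ≤ K ∧ ∀ (x₀ : RN N) (r : ℝ), 0 < r → ∀ y ∈ 𝔾.ball x₀ r, ∀ k,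
      |(x₀⁻¹ * y) k| ≤ K * r ^ 𝔾.d k := by
  -- Induction on the layer. For a coordinate of weight `n + 1`, the components of the horizontal
  -- fields have weight `n` and see only lower coordinates, so they are `O(r^n)`; integrating over
  -- length at most `r` gains the missing power.
  have key : ∀ n : ℕ, ∃ K : ℝ, 0 ≤ K ∧ ∀ γ u, 𝔾.IsHorizontal γ u → ∀ r : ℝ, 0 < r →
      ∫ t in (0 : ℝ)..1, ‖u t‖ ≤ r → ∀ k, 𝔾.d k ≤ n → ∀ t ∈ Icc (0 : ℝ) 1,
      |((γ 0)⁻¹ * γ t) k| ≤ K * r ^ 𝔾.d k := by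
    intro n
    induction n with
    | zero =>
      refine ⟨0, le_rfl, fun γ u _ r _ _ k hk ↦ ?_⟩
      have := (𝔾.d_mem k).1
      omega
    | succ n ih =>
      obtain ⟨K, hK, ih⟩ := ih
      have hC : ∀ k j, ∃ C : ℝ, 0 ≤ C ∧ (𝔾.d k = n + 1 → 𝔾.d j = 1 → ∀ R : ℝ, 0 ≤ R → ∀ z : RN N,
          (∀ i, 𝔾.d i ≤ n → |z i| ≤ K * R ^ 𝔾.d i) → |𝔾.field j z k| ≤ C * R ^ n) := by
        intro k j
        by_cases hkj : 𝔾.d k = n + 1 ∧ 𝔾.d j = 1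
        · have h1 : 𝔾.fieldPoly k j ∈ polyWt (fun i ↦ (𝔾.d i : ℤ)) {(n : ℤ)} := by
            have := 𝔾.fieldPoly_mem k j
            have h2 : 𝔾.wt k - 𝔾.wt j = n := by
              simp only [wt, hkj.1, hkj.2]
              simp
            rwa [h2] at this
          obtain ⟨C, hC0, hC⟩ := exists_bound_polyFun_of_homogeneous h1 hK
          refine ⟨C, hC0, fun _ _ R hR z hz ↦ ?_⟩
          rw [← polyFun_fieldPoly]
          exact hC R hR z hz fun i ↦ (𝔾.d_mem i).1
        · exact ⟨0, le_rfl, fun h1 h2 ↦ absurd ⟨h1, h2⟩ hkj⟩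
      choose C hC0 hC using hC
      let C' := ∑ k, ∑ j, C k j
      have hCC' : ∀ k j, C k j ≤ C' := fun k j ↦
        (Finset.single_le_sum (f := fun j ↦ C k j) (fun _ _ ↦ hC0 _ _) (Finset.mem_univ j)).trans
          (Finset.single_le_sum (f := fun k ↦ ∑ j, C k j)
            (fun _ _ ↦ Finset.sum_nonneg fun _ _ ↦ hC0 _ _) (Finset.mem_univ k))
      have hC'0 : 0 ≤ C' := Finset.sum_nonneg fun _ _ ↦ Finset.sum_nonneg fun _ _ ↦ hC0 _ _
      refine ⟨K + N * C', by positivity, fun γ u h r hr hur k hk t ht ↦ ?_⟩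
      by_cases hkn : 𝔾.d k ≤ n
      · refine (ih γ u h r hr hur k hkn t ht).trans ?_
        gcongr
        have : 0 ≤ N * C' := by positivity
        linarith
      have hkn' : 𝔾.d k = n + 1 := by omega
      have h1 := h.abs_translate_apply_le k (B := C' * r ^ n) (by positivity) (fun s hs j ↦
        (hC k j.1 hkn' j.2 r hr.le _ fun i hi ↦ ih γ u h r hr hur i hi s hs).trans
          (by gcongr; exact hCC' _ _)) ht
      refine h1.trans ?_
      calc (∫ t in (0 : ℝ)..1, ‖u t‖) * (N * (C' * r ^ n)) ≤ r * (N * (C' * r ^ n)) := by gcongr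
        _ = N * C' * r ^ 𝔾.d k := by rw [hkn']; ring
        _ ≤ _ := by gcongr; linarith
  obtain ⟨K, hK, h⟩ := key 𝔾.step
  refine ⟨K, hK, fun x₀ r hr y hy k ↦ ?_⟩
  have hy' : 𝔾.ccDist x₀ y < ENNReal.ofReal r := hy
  rw [ccDist, sInf_lt_iff] at hy'
  obtain ⟨L, ⟨γ, u, hγ, h0, h1, rfl⟩, hL⟩ := hy'
  have h2 := h γ u hγ r hr ((ENNReal.ofReal_lt_ofReal_iff hr).1 hL).le k (𝔾.d_mem k).2 1 (by simp)
  rwa [h0, h1] at h2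

end CarnotGroup

/-! ### Dilations and their Jacobian -/

namespace CarnotGroup

open MvPolynomial

variable {N : ℕ} [Group (RN N)] [LieGroup 𝓘(ℝ, RN N) ∞ (RN N)] (𝔾 : CarnotGroup N)

lemma homDim_eq : 𝔾.homDim = ∑ i, 𝔾.d i := by
  classical
  rw [homDim, ← Finset.sum_fiberwise_of_maps_to (s := Finset.univ) (t := Finset.Icc 1 𝔾.step)
    (g := 𝔾.d) fun i _ ↦ Finset.mem_Icc.2 (𝔾.d_mem i)]
  refine Finset.sum_congr rfl fun j hj ↦ ?_
  have h1 : 𝔾.V j = Submodule.span ℝ (range (𝔾.X ∘ (Subtype.val : {i // 𝔾.d i = j} → Fin N))) := by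
    rw [𝔾.adapted j (Finset.mem_Icc.1 hj)]
    congr 1
    ext v
    simp
  rw [h1, finrank_span_eq_card (𝔾.X.linearIndependent.comp _ Subtype.val_injective),
    Finset.sum_congr rfl fun i hi ↦ (Finset.mem_filter.1 hi).2, Finset.sum_const,
    Fintype.card_subtype, smul_eq_mul, mul_comm]

/-- The dilation `δ_r`. -/
def dilation (r : ℝ) : RN N →L[ℝ] RN N :=
  LinearMap.toContinuousLinearMap
    { toFun := fun z ↦ WithLp.toLp 2 fun i ↦ r ^ 𝔾.d i * z i
      map_add' := fun x y ↦ by ext i; simp [mul_add]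
      map_smul' := fun c x ↦ by ext i; simp [mul_left_comm] }

@[simp] lemma dilation_apply (r : ℝ) (z : RN N) (i : Fin N) :
    𝔾.dilation r z i = r ^ 𝔾.d i * z i := rfl

lemma det_dilation (r : ℝ) : (𝔾.dilation r).det = r ^ 𝔾.homDim := by
  classical
  let e := (EuclideanSpace.basisFun (Fin N) ℝ).toBasis
  change LinearMap.det (𝔾.dilation r : RN N →ₗ[ℝ] RN N) = _
  have hM : LinearMap.toMatrix e e (𝔾.dilation r : RN N →ₗ[ℝ] RN N) =
      Matrix.diagonal fun i ↦ r ^ 𝔾.d i := by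
    ext k j
    rw [LinearMap.toMatrix_apply, Matrix.diagonal_apply]
    simp [e]
  rw [← LinearMap.det_toMatrix e, hM, Matrix.det_diagonal, Finset.prod_pow_eq_pow_sum, homDim_eq]

lemma dilation_surjective {r : ℝ} (hr : r ≠ 0) : Function.Surjective (𝔾.dilation r) := by
  intro y
  refine ⟨WithLp.toLp 2 fun i ↦ y i / r ^ 𝔾.d i, ?_⟩
  ext i
  have : r ^ 𝔾.d i ≠ 0 := pow_ne_zero _ hr
  simp only [dilation_apply]
  field_simp

lemma dilation_injective {r : ℝ} (hr : r ≠ 0) : Function.Injective (𝔾.dilation r) :=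
  LinearMap.injective_iff_surjective.2 (𝔾.dilation_surjective hr)

lemma hasFDerivAt_mul_dilation (x₀ : RN N) (r : ℝ) (z : RN N) :
    HasFDerivAt (fun z ↦ x₀ * 𝔾.dilation r z)
      ((fderiv ℝ (fun y ↦ x₀ * y) (𝔾.dilation r z)).comp (𝔾.dilation r)) z :=
  (differentiable_mul_left x₀ (𝔾.dilation r z)).hasFDerivAt.comp z (𝔾.dilation r).hasFDerivAt

lemma det_fderiv_mul_dilation (x₀ : RN N) (r : ℝ) (z : RN N) :
    ((fderiv ℝ (fun y ↦ x₀ * y) (𝔾.dilation r z)).comp (𝔾.dilation r)).det = r ^ 𝔾.homDim := by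
  have h : ((fderiv ℝ (fun y ↦ x₀ * y) (𝔾.dilation r z)).comp (𝔾.dilation r)).det =
    (fderiv ℝ (fun y ↦ x₀ * y) (𝔾.dilation r z)).det * (𝔾.dilation r).det := LinearMap.det_comp _ _
  rw [h, 𝔾.det_fderiv_mul, 𝔾.det_dilation, one_mul]

/-- The polynomial `P ∘ δ_r`. -/
def dilatePoly (r : ℝ) (P : MvPolynomial (Fin N) ℝ) : MvPolynomial (Fin N) ℝ :=
  ∑ J ∈ P.support, monomial J (r ^ 𝔾.homNorm (fun i ↦ J i) * coeff J P)

lemma coeff_dilatePoly (r : ℝ) (P : MvPolynomial (Fin N) ℝ) (J : Fin N →₀ ℕ) :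
    coeff J (𝔾.dilatePoly r P) = r ^ 𝔾.homNorm (fun i ↦ J i) * coeff J P := by
  classical
  rw [dilatePoly, coeff_sum]
  simp only [coeff_monomial]
  rw [Finset.sum_ite_eq']
  split_ifs with h
  · rfl
  · rw [notMem_support_iff.1 h, mul_zero]

lemma support_dilatePoly_subset (r : ℝ) (P : MvPolynomial (Fin N) ℝ) :
    (𝔾.dilatePoly r P).support ⊆ P.support := by
  intro J hJ
  rw [mem_support_iff, coeff_dilatePoly] at hJ
  exact mem_support_iff.2 (right_ne_zero_of_mul hJ)

lemma polyFun_dilatePoly (r : ℝ) (P : MvPolynomial (Fin N) ℝ) (z : RN N) :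
    polyFun (𝔾.dilatePoly r P) z = polyFun P (𝔾.dilation r z) := by
  rw [dilatePoly, polyFun_sum, polyFun_eq_sum]
  refine Finset.sum_congr rfl fun J _ ↦ ?_
  rw [polyFun_monomial]
  simp only [dilation_apply, mul_pow, Finset.prod_mul_distrib, ← pow_mul,
    Finset.prod_pow_eq_pow_sum, homNorm]
  ring

end CarnotGroup

end

theorem lemma3p4 {N : ℕ} [Group (RN N)] [LieGroup 𝓘(ℝ, RN N) ∞ (RN N)] (𝔾 : CarnotGroup N)
    (k : ℕ) (hk : 0 < k) (A : ℝ) (hA : 0 < A) :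
    ∃ C : ℝ, 0 < C ∧
      ∀ (x₀ : RN N) (r : ℝ), 0 < r →
      ∀ E : Set (RN N), NullMeasurableSet E volume → E ⊆ 𝔾.ball x₀ r →
        ENNReal.ofReal (A * r ^ 𝔾.homDim) ≤ volume E →
      ∀ P : MvPolynomial (Fin N) ℝ, 𝔾.HomDegreeLE P k →
      ∀ α : Fin N → ℕ,
        |𝔾.iterDeriv α (polyFun P) x₀| ≤
          C / r ^ (𝔾.homDim + 𝔾.homNorm α) * ∫ y in E, |polyFun P y| := by
  obtain ⟨K, hK, hball⟩ := 𝔾.exists_ball_subset_box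
  let S := (𝔾.finite_homNorm_le_finsupp k).toFinset
  obtain ⟨C₀, hC₀, hcoeff⟩ := exists_coeff_le_integral S K hA
  obtain ⟨M, hM, hderiv⟩ := 𝔾.exists_iterDeriv_le k S
  -- `M` may vanish; `M + 1` keeps the constant positive.
  refine ⟨(M + 1) * C₀, by positivity, fun x₀ r hr E hE hEball hEvol P hP α ↦ ?_⟩
  obtain ⟨E₀, hE₀E, hE₀, hE₀ae⟩ := hE.exists_measurable_subset_ae_eq
  rw [← measure_congr hE₀ae] at hEvol
  rw [← setIntegral_congr_set hE₀ae]
  let Φ : RN N → RN N := fun z ↦ x₀ * 𝔾.dilation r z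
  let s := Φ ⁻¹' E₀
  have hΦ : Continuous Φ :=
    (differentiable_mul_left x₀).continuous.comp (𝔾.dilation r).continuous
  have hs : MeasurableSet s := hE₀.preimage hΦ.measurable
  have hinj : Function.Injective Φ := (mul_right_injective x₀).comp (𝔾.dilation_injective hr.ne')
  have hsurj : Function.Surjective Φ :=
    (mul_left_surjective x₀).comp (𝔾.dilation_surjective hr.ne')
  have himage : Φ '' s = E₀ := image_preimage_eq _ hsurj
  have hder : ∀ z ∈ s, HasFDerivWithinAt Φ
      ((fderiv ℝ (fun y ↦ x₀ * y) (𝔾.dilation r z)).comp (𝔾.dilation r)) s z :=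
    fun z _ ↦ (𝔾.hasFDerivAt_mul_dilation x₀ r z).hasFDerivWithinAt
  have hrQ : 0 < r ^ 𝔾.homDim := pow_pos hr _
  have hsvol : ENNReal.ofReal A ≤ volume s := by
    have h1 := lintegral_abs_det_fderiv_eq_addHaar_image volume hs hder hinj.injOn
    simp only [𝔾.det_fderiv_mul_dilation, abs_of_pos hrQ] at h1
    rw [himage, setLIntegral_const] at h1
    rw [← h1, mul_comm A, ENNReal.ofReal_mul hrQ.le] at hEvol
    exact (ENNReal.mul_le_mul_iff_right (ENNReal.ofReal_pos.2 hrQ).ne' ENNReal.ofReal_ne_top).1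
      hEvol
  have hsbox : s ⊆ {z | ∀ i, |z i| ≤ K} := by
    intro z hz i
    have h1 := hball x₀ r hr _ (hEball (hE₀E hz)) i
    simp only [Φ, inv_mul_cancel_left, CarnotGroup.dilation_apply, abs_mul, abs_pow,
      abs_of_pos hr] at h1
    rw [mul_comm K] at h1
    exact le_of_mul_le_mul_left h1 (pow_pos hr _)
  obtain ⟨P', hP', hPP'⟩ := 𝔾.exists_translate x₀ (𝔾.homDegreeLE_iff.1 hP)
  rw [← 𝔾.homDegreeLE_iff] at hP'
  have hP'S : P'.support ⊆ S := fun J hJ ↦ by simpa [S] using hP' J hJ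
  let G := 𝔾.dilatePoly r P'
  have hint : ∫ y in E₀, |polyFun P y| = r ^ 𝔾.homDim * ∫ z in s, |polyFun G z| := by
    have h1 := integral_image_eq_integral_abs_det_fderiv_smul volume hs hder hinj.injOn
      (fun y ↦ |polyFun P y|)
    simp only [𝔾.det_fderiv_mul_dilation, abs_of_pos hrQ, smul_eq_mul] at h1
    rw [himage, integral_const_mul] at h1
    rw [h1]
    simp only [G, 𝔾.polyFun_dilatePoly, hPP', Φ]
  have hG := hcoeff G ((𝔾.support_dilatePoly_subset r P').trans hP'S) s hs hsbox hsvol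
  set I := ∫ z in s, |polyFun G z| with hI
  have hI0 : 0 ≤ I := integral_nonneg fun _ ↦ abs_nonneg _
  have hrα : 0 < r ^ 𝔾.homNorm α := pow_pos hr _
  -- Dilation multiplies each coefficient of weight `|α|` by exactly `r^|α|`, and no other
  -- coefficient matters. This is the source of the power of `r` attached to `α`.
  have hmain := hderiv P' hP' hP'S α (C₀ * I / r ^ 𝔾.homNorm α) (by positivity) fun J hJ ↦ by
    have h1 := hG J
    rw [𝔾.coeff_dilatePoly, hJ, abs_mul, abs_of_pos hrα] at h1
    rwa [le_div_iff₀ hrα, mul_comm]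
  rw [𝔾.polyFun_iterOp_translate α hPP', mul_one, 𝔾.polyFun_iterOp] at hmain
  refine hmain.trans ?_
  rw [hint, pow_add]
  calc M * (C₀ * I / r ^ 𝔾.homNorm α) ≤ (M + 1) * (C₀ * I / r ^ 𝔾.homNorm α) := by
        gcongr
        linarith
    _ = _ := by field_simp
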